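/- Theorem (Streaming shifting lemma). Unit disc cover (UDC) asks for the minimum number $\mathrm{OPT}(P)$ of closed discs of radius $1$ that cover a finite set $P$ of points of the plane; discs are taken in a fixed $L_p$ norm, $1\le p\le\infty$. A streaming algorithm with $s$ bits of space reads the points one by one in a single pass, each time updating (possibly at random, with fresh coin tosses) a memory of $s$ bits, and finally reports a number computed from its memory. It has approximation ratio $\rho$ on a stream $P$ if the reported number lies in $[\mathrm{OPT}(P),\,\rho\,\mathrm{OPT}(P)]$. Let $n\ge 2$ and $\ell\ge 2$ be integers, and let $0<\varepsilon\le 1/2$. Inputs are streams of at most $n$ points (repetitions allowed) whose coordinates belong to a known set of at most $n^{c}$ real numbers of absolute value at most $n^{c}$, where $c$ is a constant (the coordinates are bounded by $\mathrm{poly}(n)$ and are represented by $O(\log n)$ bits). A window is a set $[a,a+2\ell)\times(b-2\ell,b]$ with $a,b$ even integers. Let $\mathcal A$ be a streaming algorithm for UDC restricted to windows: for every window $W$ it gives a streaming algorithm $\mathcal A_W$ with $s$ bits of space which, on every such stream of points of $W$, has approximation ratio $r_{\mathcal A}$ with probability $1$ (for instance, because $\mathcal A$ is deterministic). Then there is a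 streaming algorithm for UDC which, on every input stream, has approximation ratio $(1+\varepsilon)\left(1+\frac{4}{\ell}\right)^{2} r_{\mathcal A}$ with probability at least $0.99$, and which uses $$O\!\left(\varepsilon^{-2}\,\ell^{4}\,\log(\ell)\,\bigl(s+\log(1/\varepsilon)\log n\bigr)\right)$$ bits of space. The constant in the $O(\cdot)$ depends only on $c$. -/

import Mathlib

noncomputable section

namespace UnitDiscCover

/-- The plane with the `L_p` norm (`p = 2`: Euclidean discs; `p = 1`, `p = ∞`: squares). -/
abbrev Plane (p : ENNReal) : Type := PiLp p (fun _ : Fin 2 => ℝ)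

/-- The closed unit discs centred at the points of `D` cover every point occurring in `P`. -/
def Covers {p : ENNReal} [Fact (1 ≤ p)] (D : Finset (Plane p)) (P : List (Plane p)) : Prop :=
  ∀ x ∈ P, ∃ z ∈ D, x ∈ Metric.closedBall z 1

/-- The optimum of unit disc cover: the least number of closed unit discs that cover `P`.
(The infimum is over a nonempty set of natural numbers, see `exists_cover`.) -/
def opt {p : ENNReal} [Fact (1 ≤ p)] (P : List (Plane p)) : ℕ :=
  sInf {k : ℕ | ∃ D : Finset (Plane p), D.card = k ∧ Covers D P}

theorem exists_cover {p : ENNReal} [Fact (1 ≤ p)] (P : List (Plane p)) :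
    {k : ℕ | ∃ D : Finset (Plane p), D.card = k ∧ Covers D P}.Nonempty := by
  classical
  exact ⟨_, P.toFinset, rfl, fun x hx => ⟨x, by simpa using hx, by simp⟩⟩

/-- The contents of a memory of `s` bits. -/
abbrev Memory (s : ℕ) : Type := Fin s → Bool

/-- A randomized one-pass streaming algorithm with `s` bits of memory that reads items of type
`X` and reports a real number.  Coin tosses are fresh at every step: all that is carried from
one item of the stream to the next (random hash functions included) is the content of the
memory.  A deterministic algorithm is one all of whose distributions are point masses. -/
structure StreamAlg (X : Type) (s : ℕ) where
  /-- the distribution of the initial memory content -/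
  init : PMF (Memory s)
  /-- the distribution of the new memory content, given the old one and the item read -/
  step : Memory s → X → PMF (Memory s)
  /-- the number reported at the end of the stream, computed from the memory content -/
  out : Memory s → ℝ

/-- The distribution of the memory content after the stream `P` has been read once. -/
def StreamAlg.run {X : Type} {s : ℕ} (A : StreamAlg X s) (P : List X) : PMF (Memory s) :=
  P.foldl (fun μ x => μ.bind (fun m => A.step m x)) A.init

/-- On every stream `P` of the class `S`, with probability at least `q`, the number reported
by `A` lies between `opt P` and `ρ * opt P`. -/
def StreamAlg.Approximates {p : ENNReal} [Fact (1 ≤ p)] {s : ℕ} (A : StreamAlg (Plane p) s)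
    (S : Set (List (Plane p))) (ρ q : ℝ) : Prop :=
  ∀ P ∈ S, ENNReal.ofReal q ≤ (A.run P).toOuterMeasure
    {m | (opt P : ℝ) ≤ A.out m ∧ A.out m ≤ ρ * (opt P : ℝ)}

/-- `U` is an admissible set of coordinates for inputs of `n` points: the coordinates are
at most `n ^ c` in absolute value, and there are at most `n ^ c = 2 ^ (c * log₂ n)` of them, so
that each is represented by `O(log n)` bits. -/
def IsCoordinateSet (c n : ℕ) (U : Finset ℝ) : Prop :=
  U.card ≤ n ^ c ∧ ∀ u ∈ U, |u| ≤ (n : ℝ) ^ c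

/-- The streams of at most `n` points all of whose coordinates lie in `U`. -/
def streams (p : ENNReal) (U : Finset ℝ) (n : ℕ) : Set (List (Plane p)) :=
  {P | P.length ≤ n ∧ ∀ x ∈ P, ∀ i, x i ∈ U}

/-- The `2ℓ × 2ℓ` window with top left corner `(2 * w.1, 2 * w.2)`, closed on the left and at
the top, open on the right and at the bottom. -/
def window (p : ENNReal) (ℓ : ℕ) (w : ℤ × ℤ) : Set (Plane p) :=
  {x | 2 * (w.1 : ℝ) ≤ x 0 ∧ x 0 < 2 * (w.1 : ℝ) + 2 * (ℓ : ℝ) ∧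
    2 * (w.2 : ℝ) - 2 * (ℓ : ℝ) < x 1 ∧ x 1 ≤ 2 * (w.2 : ℝ)}

/-- The streams of at most `n` points that lie in the window `w` and have coordinates in `U`. -/
def windowStreams (p : ENNReal) (U : Finset ℝ) (n ℓ : ℕ) (w : ℤ × ℤ) :
    Set (List (Plane p)) :=
  {P | P ∈ streams p U n ∧ ∀ x ∈ P, x ∈ window p ℓ w}

end UnitDiscCover

end

namespace UnitDiscCover

/-! The proof is the shifting method combined with adaptive distinct sampling of windows. Each of
the `ℓ ^ 2` shifts cuts the plane into `2ℓ × 2ℓ` windows. For every shift, the sum of the optima of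
the windows is at least the global optimum. In each coordinate a disc meets two intervals instead of
one for at most one of the `ℓ` shifts, so summed over all shifts it meets at most `(ℓ + 1) ^ 2`
windows. By averaging, some shift has a sum of at most `(1 + 1 / ℓ) ^ 2` times the optimum
(`exists_shift`), and it suffices to estimate the sum for every shift and take the minimum.

There may be too many nonempty windows to run the given algorithm on all of them. Windows are
therefore coded by elements of a field of order `2 ^ m`, and a pairwise independent affine hash
samples them at rate `2 ^ (-j)`, where `j` is the first level that leaves at most `k` windows. Each
nonempty window has optimum between `1` and `4 * ℓ ^ 2`, so Chebyshev's inequality with `k` of order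
`ℓ ^ 2 / ε ^ 2` makes the rescaled sampled sum accurate for all but `1 / 64` of the seeds
(`card_inaccurate_seeds_le`). A median over `T = O(log ℓ)` seeds lowers the failure rate to `4⁻ᵀ`,
which survives a union bound over the shifts.

One pass suffices because levels only rise and the sampled sets are nested: a window sampled now was
sampled ever since its first point arrived, so its stored memory is complete (`table_append_congr`).
The window algorithms succeed with probability one, so they can be replaced by deterministic choices
within their supports; the only randomness left is the tuple of hash seeds, which is stored. -/

/-! ### Streaming algorithms from deterministic state functions -/

theorem StreamAlg.run_append_singleton {X : Type} {s : ℕ} (A : StreamAlg X s) (P : List X)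
    (x : X) : A.run (P ++ [x]) = (A.run P).bind (fun m => A.step m x) := by
  simp [StreamAlg.run, List.foldl_append]

/-- A streaming algorithm can be run deterministically inside its support. -/
theorem StreamAlg.exists_deterministic {X : Type} {s : ℕ} (A : StreamAlg X s) :
    ∃ (m₀ : Memory s) (f : Memory s → X → Memory s),
      ∀ P : List X, P.foldl f m₀ ∈ (A.run P).support := by
  choose f hf using fun m x => (A.step m x).support_nonempty
  obtain ⟨m₀, h₀⟩ := A.init.support_nonempty
  refine ⟨m₀, f, fun P => ?_⟩
  induction P using List.reverseRecOn with
  | nil => exact h₀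
  | append_singleton P x ih =>
    rw [StreamAlg.run_append_singleton, List.foldl_append, PMF.mem_support_bind_iff]
    exact ⟨_, ih, hf _ _⟩

theorem mem_of_one_le_toOuterMeasure {α : Type} {μ : PMF α} {S : Set α}
    (h : ENNReal.ofReal 1 ≤ μ.toOuterMeasure S) {a : α} (ha : a ∈ μ.support) : a ∈ S := by
  have h1 : μ.toOuterMeasure S = 1 :=
    le_antisymm (by
      rw [PMF.toOuterMeasure_apply, ← μ.tsum_coe]
      exact ENNReal.tsum_le_tsum fun a => Set.indicator_le_self _ _ _) (by simpa using h)
  exact (μ.toOuterMeasure_apply_eq_one_iff S).1 h1 ha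

/-- A family of state functions on streams, each of which can be updated item by item, is
realised by a streaming algorithm that stores a uniformly random index and its state. -/
theorem exists_streamAlg_of_states {X Ω σ : Type} [Fintype Ω] [Nonempty Ω] [Fintype σ]
    (St : Ω → List X → σ)
    (hSt : ∀ ω P Q x, St ω P = St ω Q → St ω (P ++ [x]) = St ω (Q ++ [x]))
    (out : Ω → σ → ℝ) (s : ℕ) (hs : Fintype.card Ω * Fintype.card σ ≤ 2 ^ s) :
    ∃ B : StreamAlg X s, ∀ (P : List X) (G : Set ℝ) (q : ℝ),
      q * Fintype.card Ω ≤ ({ω | out ω (St ω P) ∈ G} : Set Ω).ncard →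
      ENNReal.ofReal q ≤ (B.run P).toOuterMeasure {m | B.out m ∈ G} := by
  classical
  have hcard : Fintype.card (Ω × σ) ≤ Fintype.card (Memory s) := by simpa using hs
  obtain ⟨enc⟩ := Function.Embedding.nonempty_of_card_le hcard
  -- The update decodes the memory to any stream that could have produced it; by `hSt` the choice of
  -- that stream does not affect the new state.
  let stp : Memory s → X → Memory s := fun m x =>
    if h : ∃ q : Ω × List X, enc (q.1, St q.1 q.2) = m then
      enc (h.choose.1, St h.choose.1 (h.choose.2 ++ [x])) else m
  have hstp : ∀ ω P x, stp (enc (ω, St ω P)) x = enc (ω, St ω (P ++ [x])) := by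
    intro ω P x
    have h : ∃ q : Ω × List X, enc (q.1, St q.1 q.2) = enc (ω, St ω P) := ⟨(ω, P), rfl⟩
    have h2 := h.choose_spec
    have h3 := Prod.ext_iff.1 (enc.injective h2)
    simp only at h3
    obtain ⟨h4, h5⟩ := h3
    simp only [stp, dif_pos h]
    rw [h4] at h5 ⊢
    rw [hSt _ _ _ x h5]
  let o : Memory s → ℝ := fun m =>
    if h : ∃ q : Ω × σ, enc q = m then out h.choose.1 h.choose.2 else 0
  have ho : ∀ q, o (enc q) = out q.1 q.2 := by
    intro q
    have h : ∃ q' : Ω × σ, enc q' = enc q := ⟨q, rfl⟩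
    have h2 := enc.injective h.choose_spec
    simp only [o, dif_pos h]
    rw [h2]
  let B : StreamAlg X s :=
    { init := (PMF.uniformOfFintype Ω).map (fun ω => enc (ω, St ω []))
      step := fun m x => PMF.pure (stp m x)
      out := o }
  have hrun : ∀ P, B.run P = (PMF.uniformOfFintype Ω).map (fun ω => enc (ω, St ω P)) := by
    intro P
    induction P using List.reverseRecOn with
    | nil => rfl
    | append_singleton P x ih =>
      rw [StreamAlg.run_append_singleton, ih]
      change PMF.bind _ (PMF.pure ∘ fun m => stp m x) = _
      rw [PMF.bind_pure_comp, PMF.map_comp]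
      congr 1
      funext ω
      exact hstp ω P x
  refine ⟨B, fun P G q h => ?_⟩
  rw [hrun, PMF.toOuterMeasure_map_apply]
  have hset : (fun ω => enc (ω, St ω P)) ⁻¹' {m | B.out m ∈ G} = {ω | out ω (St ω P) ∈ G} := by
    ext ω
    simp [B, ho]
  rw [hset, PMF.toOuterMeasure_uniformOfFintype_apply]
  have hpos : (0 : ℝ) < Fintype.card Ω := by exact_mod_cast Fintype.card_pos
  rw [Set.ncard_eq_toFinset_card', Set.toFinset_card] at h
  rw [ENNReal.ofReal_le_iff_le_toReal]
  · rw [ENNReal.toReal_div, le_div_iff₀ (by simpa using hpos)]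
    simpa using h
  · exact ENNReal.div_ne_top (by simp) (by simp)

/-! ### Second moments and adaptive sampling -/

open Finset

/-- The sampled weight `∑ v w` over the elements `w` of `N` selected by `h`. -/
def sampledSum {Ω ι : Type} (I : Ω → ι → Prop) [∀ h w, Decidable (I h w)] (N : Finset ι)
    (v : ι → ℝ) (h : Ω) : ℝ := ∑ w ∈ N with I h w, v w

section Chebyshev

variable {Ω ι : Type} [Fintype Ω] (I : Ω → ι → Prop) [∀ h w, Decidable (I h w)]
  (N : Finset ι) (v : ι → ℝ) (p : ℝ)

/-- Pairwise independence kills the covariances, leaving `p - p ^ 2 ≤ p` times the squared weights.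
Expectations are written as sums over all seeds, hence the factor `Fintype.card Ω`. -/
theorem sum_sampledSum_sub_sq_le
    (h₁ : ∀ w ∈ N, ((#{h | I h w} : ℕ) : ℝ) = p * Fintype.card Ω)
    (h₂ : ∀ w ∈ N, ∀ w' ∈ N, w ≠ w' →
      ((#{h | I h w ∧ I h w'} : ℕ) : ℝ) = p ^ 2 * Fintype.card Ω) :
    ∑ h, (sampledSum I N v h - p * ∑ w ∈ N, v w) ^ 2 ≤
      p * Fintype.card Ω * ∑ w ∈ N, v w ^ 2 := by
  classical
  have e1 : ∀ h, sampledSum I N v h - p * ∑ w ∈ N, v w =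
      ∑ w ∈ N, v w * ((if I h w then 1 else 0) - p) := by
    intro h
    simp only [sampledSum, sum_filter, mul_sum, ← sum_sub_distrib]
    refine sum_congr rfl fun w _ => ?_
    split_ifs <;> ring
  have s1 : ∀ w ∈ N, ∑ h, (if I h w then (1 : ℝ) else 0) = p * Fintype.card Ω := by
    intro w hw
    rw [← h₁ w hw, sum_boole]
  have key : ∀ w ∈ N, ∀ w' ∈ N,
      ∑ h : Ω, ((if I h w then (1 : ℝ) else 0) - p) * ((if I h w' then 1 else 0) - p) =
        if w = w' then (p - p ^ 2) * Fintype.card Ω else 0 := by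
    intro w hw w' hw'
    have e2 : ∀ h : Ω, ((if I h w then (1 : ℝ) else 0) - p) * ((if I h w' then 1 else 0) - p) =
        (if I h w ∧ I h w' then (1 : ℝ) else 0) - p * (if I h w then (1 : ℝ) else 0)
          - p * (if I h w' then (1 : ℝ) else 0) + p ^ 2 := by
      intro h
      by_cases a : I h w <;> by_cases b : I h w' <;> simp [a, b] <;> ring
    simp_rw [e2, sum_add_distrib, sum_sub_distrib, ← mul_sum, s1 w hw, s1 w' hw']
    rw [sum_boole]
    simp only [sum_const, card_univ, nsmul_eq_mul]
    split_ifs with hww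
    · subst hww
      simp only [and_self]
      rw [h₁ w hw]
      ring
    · rw [h₂ w hw w' hw' hww]
      ring
  calc ∑ h, (sampledSum I N v h - p * ∑ w ∈ N, v w) ^ 2
      = ∑ h : Ω, ∑ w ∈ N, ∑ w' ∈ N, v w * v w' *
          (((if I h w then (1 : ℝ) else 0) - p) * ((if I h w' then 1 else 0) - p)) := by
        refine sum_congr rfl fun h _ => ?_
        rw [e1, sq, sum_mul_sum]
        refine sum_congr rfl fun w _ => sum_congr rfl fun w' _ => ?_
        ring
    _ = ∑ w ∈ N, ∑ w' ∈ N, v w * v w' *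
          (if w = w' then (p - p ^ 2) * Fintype.card Ω else 0) := by
        rw [sum_comm]
        refine sum_congr rfl fun w hw => ?_
        rw [sum_comm]
        refine sum_congr rfl fun w' hw' => ?_
        rw [← mul_sum, key w hw w' hw']
    _ = ∑ w ∈ N, v w ^ 2 * ((p - p ^ 2) * Fintype.card Ω) := by
        refine sum_congr rfl fun w hw => ?_
        simp only [mul_ite, mul_zero, sum_ite_eq, hw, if_true]
        ring
    _ = ((p - p ^ 2) * Fintype.card Ω) * ∑ w ∈ N, v w ^ 2 := by rw [← sum_mul]; ring
    _ ≤ _ := by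
        refine mul_le_mul_of_nonneg_right ?_ (sum_nonneg fun _ _ => sq_nonneg _)
        refine mul_le_mul_of_nonneg_right ?_ (Nat.cast_nonneg _)
        nlinarith [sq_nonneg p]

theorem card_deviation_mul_sq_le
    (h₁ : ∀ w ∈ N, ((#{h | I h w} : ℕ) : ℝ) = p * Fintype.card Ω)
    (h₂ : ∀ w ∈ N, ∀ w' ∈ N, w ≠ w' →
      ((#{h | I h w ∧ I h w'} : ℕ) : ℝ) = p ^ 2 * Fintype.card Ω)
    {t : ℝ} (ht : 0 ≤ t) :
    ((#{h | t ≤ |sampledSum I N v h - p * ∑ w ∈ N, v w|} : ℕ) : ℝ) * t ^ 2 ≤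
      p * Fintype.card Ω * ∑ w ∈ N, v w ^ 2 := by
  refine le_trans ?_ (sum_sampledSum_sub_sq_le I N v p h₁ h₂)
  rw [← nsmul_eq_mul]
  refine (card_nsmul_le_sum _ _ _ ?_).trans
    (sum_le_sum_of_subset_of_nonneg (filter_subset _ _) fun _ _ _ => sq_nonneg _)
  intro h hh
  have := (mem_filter.1 hh).2
  rw [← sq_abs (sampledSum I N v h - _)]
  exact pow_le_pow_left₀ ht this 2

end Chebyshev

/-- Adaptive sampling: at the first level at which at most `k` elements are sampled, the
rescaled sampled weight is accurate for all but a `1 / 64` fraction of the seeds. -/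
theorem card_inaccurate_seeds_le {Ω ι : Type} [Fintype Ω] [Nonempty Ω]
    (I : ℕ → Ω → ι → Prop) [∀ j h w, Decidable (I j h w)] (N : Finset ι) (v : ι → ℝ)
    (m k : ℕ) (M δ : ℝ)
    (hI₀ : ∀ h w, I 0 h w)
    (h₁ : ∀ j ≤ m, ∀ w, ((#{h | I j h w} : ℕ) : ℝ) = (2 ^ j)⁻¹ * Fintype.card Ω)
    (h₂ : ∀ j ≤ m, ∀ w w', w ≠ w' →
      ((#{h | I j h w ∧ I j h w'} : ℕ) : ℝ) = ((2 ^ j)⁻¹) ^ 2 * Fintype.card Ω)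
    (hN : #N ≤ 2 ^ m) (hv : ∀ w ∈ N, 1 ≤ v w ∧ v w ≤ M)
    (hδ : 0 < δ) (hδ1 : δ ≤ 1) (hM : 1 ≤ M) (hk : 640 * M ≤ δ ^ 2 * k) :
    64 * (({h | ∃ j, #{w ∈ N | I j h w} ≤ k ∧ (∀ i < j, k < #{w ∈ N | I i h w}) ∧
      δ * ∑ w ∈ N, v w < |2 ^ j * sampledSum (I j) N v h - ∑ w ∈ N, v w|} : Set Ω).ncard : ℝ) ≤
        Fintype.card Ω := by
  classical
  set S := ∑ w ∈ N, v w with hS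
  set Bd : Set Ω := {h | ∃ j, #{w ∈ N | I j h w} ≤ k ∧ (∀ i < j, k < #{w ∈ N | I i h w}) ∧
      δ * S < |2 ^ j * sampledSum (I j) N v h - S|} with hBd
  have hΩ : (0 : ℝ) < Fintype.card Ω := by exact_mod_cast Fintype.card_pos
  have hNS : (#N : ℝ) ≤ S := by
    have := card_nsmul_le_sum N v 1 fun w hw => (hv w hw).1
    simpa using this
  have hS0 : 0 ≤ S := le_trans (Nat.cast_nonneg _) hNS
  -- If all keys fit, the level is `0`, everything is sampled and the estimate is exact.
  by_cases hNk : #N ≤ k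
  · have : Bd = ∅ := by
      ext h
      simp only [hBd, Set.mem_ofPred_eq, Set.mem_empty_iff_false, iff_false]
      rintro ⟨j, -, hj, hd⟩
      rcases Nat.eq_zero_or_pos j with rfl | hj0
      · simp [sampledSum, hI₀, ← hS] at hd
        nlinarith
      · have := hj 0 hj0
        simp [hI₀] at this
        omega
    rw [this]
    simp
  push Not at hNk
  have hkpos : (640 : ℝ) ≤ k := by
    have : δ ^ 2 ≤ 1 := by nlinarith
    have h3 : (0 : ℝ) ≤ k := Nat.cast_nonneg _
    nlinarith
  have hk2 : 640 ≤ k := by exact_mod_cast hkpos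
  have hex : ∃ j, 2 * #N ≤ k * 2 ^ j :=
    ⟨m, (Nat.mul_le_mul_left 2 hN).trans (Nat.mul_le_mul_right _ (by omega))⟩
  -- `j₀` is the first level whose expected sample size is at most `k / 2`. Stopping later than `j₀`
  -- requires a deviation of `k / 2` there (event `C`); stopping by `j₀` with a bad estimate is one
  -- of the events `E j`.
  obtain ⟨j₀, hj₀, hjmin⟩ : ∃ j, 2 * #N ≤ k * 2 ^ j ∧ ∀ i < j, k * 2 ^ i < 2 * #N :=
    ⟨Nat.find hex, Nat.find_spec hex, fun i hi => not_le.1 (Nat.find_min hex hi)⟩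
  have hj₀m : j₀ ≤ m := by
    by_contra hcon
    have := hjmin m (by omega)
    have h4 : 2 * #N ≤ k * 2 ^ m :=
      (Nat.mul_le_mul_left 2 hN).trans (Nat.mul_le_mul_right _ (by omega))
    omega
  have hj₀4 : k * 2 ^ j₀ < 4 * #N := by
    rcases Nat.eq_zero_or_pos j₀ with h0 | h0
    · subst h0; omega
    · have := hjmin (j₀ - 1) (by omega)
      have e : 2 ^ j₀ = 2 * 2 ^ (j₀ - 1) := by rw [← pow_succ']; congr 1; omega
      rw [e]; nlinarith
  have hN0 : (0 : ℝ) < #N := by exact_mod_cast (by omega : 0 < #N)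
  have hSpos : 0 < S := lt_of_lt_of_le hN0 hNS
  -- `C`: too many elements sampled at level `j₀`; `E j`: inaccurate estimate at level `j`
  set C : Finset Ω := {h | (k : ℝ) / 2 ≤
    |sampledSum (I j₀) N (fun _ => 1) h - (2 ^ j₀)⁻¹ * ∑ w ∈ N, (1 : ℝ)|} with hC
  set E : ℕ → Finset Ω := fun j => {h | δ * ((2 ^ j)⁻¹ * S) ≤
    |sampledSum (I j) N v h - (2 ^ j)⁻¹ * ∑ w ∈ N, v w|} with hE
  have hsub : Bd ⊆ ↑(C ∪ (range (j₀ + 1)).biUnion E) := by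
    rintro h ⟨j, hjk, hji, hd⟩
    rw [mem_coe, mem_union]
    by_cases hjj : j ≤ j₀
    · right
      refine mem_biUnion.2 ⟨j, mem_range.2 (by omega), ?_⟩
      rw [hE, mem_filter]
      refine ⟨mem_univ _, ?_⟩
      have h2j : (0 : ℝ) < 2 ^ j := by positivity
      have e : sampledSum (I j) N v h - (2 ^ j)⁻¹ * ∑ w ∈ N, v w =
          (2 ^ j)⁻¹ * (2 ^ j * sampledSum (I j) N v h - S) := by
        rw [← hS]; field_simp
      rw [e, abs_mul, abs_of_pos (inv_pos.2 h2j)]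
      have := mul_le_mul_of_nonneg_left hd.le (inv_pos.2 h2j).le
      linarith
    · left
      rw [hC, mem_filter]
      refine ⟨mem_univ _, ?_⟩
      have h5 := hji j₀ (by omega)
      have h6 : (k : ℝ) < (#{w ∈ N | I j₀ h w} : ℕ) := by exact_mod_cast h5
      have h7 : (2 ^ j₀ : ℝ)⁻¹ * #N ≤ k / 2 := by
        rw [inv_mul_le_iff₀ (by positivity)]
        have : (2 * #N : ℝ) ≤ k * 2 ^ j₀ := by exact_mod_cast hj₀
        linarith
      simp only [sampledSum, sum_const, nsmul_eq_mul, mul_one]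
      refine le_trans ?_ (le_abs_self _)
      linarith
  have hbC : (#C : ℝ) * k ≤ 2 * Fintype.card Ω := by
    have h8 := card_deviation_mul_sq_le (I j₀) N (fun _ => 1) (2 ^ j₀)⁻¹
      (fun w _ => h₁ j₀ hj₀m w) (fun w _ w' _ hw => h₂ j₀ hj₀m w w' hw)
      (t := (k : ℝ) / 2) (by positivity)
    rw [← hC] at h8
    have h7 : (2 ^ j₀ : ℝ)⁻¹ * #N ≤ k / 2 := by
      rw [inv_mul_le_iff₀ (by positivity)]
      have : (2 * #N : ℝ) ≤ k * 2 ^ j₀ := by exact_mod_cast hj₀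
      linarith
    simp only [one_pow, sum_const, nsmul_eq_mul, mul_one] at h8
    have h9 : (2 ^ j₀ : ℝ)⁻¹ * Fintype.card Ω * #N ≤ k / 2 * Fintype.card Ω := by
      calc _ = (2 ^ j₀ : ℝ)⁻¹ * #N * Fintype.card Ω := by ring
        _ ≤ _ := mul_le_mul_of_nonneg_right h7 hΩ.le
    have h10 : (k : ℝ) * (#C * k) ≤ k * (2 * Fintype.card Ω) := by nlinarith
    exact le_of_mul_le_mul_left h10 (by linarith)
  -- One factor of `S` cancels because `∑ v ^ 2 ≤ M * S`; the other is bounded below by `#N`. The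
  -- bounds grow like `2 ^ j`, so their sum is dominated by level `j₀`.
  have hbE : ∀ j ≤ j₀, (#(E j) : ℝ) * (δ ^ 2 * #N) ≤ 2 ^ j * M * Fintype.card Ω := by
    intro j hj
    have h8 := card_deviation_mul_sq_le (I j) N v (2 ^ j)⁻¹
      (fun w _ => h₁ j (hj.trans hj₀m) w) (fun w _ w' _ hw => h₂ j (hj.trans hj₀m) w w' hw)
      (t := δ * ((2 ^ j)⁻¹ * S)) (by positivity)
    have h9 : ∑ w ∈ N, v w ^ 2 ≤ M * S := by
      rw [hS, mul_sum]
      refine sum_le_sum fun w hw => ?_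
      have := hv w hw
      nlinarith
    have h10 : (#(E j) : ℝ) * (δ * ((2 ^ j)⁻¹ * S)) ^ 2 ≤
        (2 ^ j)⁻¹ * Fintype.card Ω * (M * S) :=
      h8.trans (mul_le_mul_of_nonneg_left h9 (by positivity))
    have h2j : (0 : ℝ) < 2 ^ j := by positivity
    have h11 : S * (#(E j) * (δ ^ 2 * S)) ≤ S * (2 ^ j * M * Fintype.card Ω) := by
      have := mul_le_mul_of_nonneg_left h10 (by positivity : (0 : ℝ) ≤ (2 ^ j) ^ 2)
      have e1 : ((2 : ℝ) ^ j) ^ 2 * (#(E j) * (δ * ((2 ^ j)⁻¹ * S)) ^ 2) =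
        S * (#(E j) * (δ ^ 2 * S)) := by field_simp
      have e2 : ((2 : ℝ) ^ j) ^ 2 * ((2 ^ j)⁻¹ * Fintype.card Ω * (M * S)) =
        S * (2 ^ j * M * Fintype.card Ω) := by field_simp
      rwa [e1, e2] at this
    refine le_trans ?_ (le_of_mul_le_mul_left h11 hSpos)
    gcongr
  have hcard : (Bd.ncard : ℝ) ≤ #C + ∑ j ∈ range (j₀ + 1), (#(E j) : ℝ) := by
    have a1 := Set.ncard_le_ncard hsub (finite_toSet _)
    rw [Set.ncard_coe_finset] at a1
    have a2 := a1.trans ((card_union_le _ _).trans (Nat.add_le_add_left card_biUnion_le _))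
    exact_mod_cast a2
  have hsumE : (∑ j ∈ range (j₀ + 1), (#(E j) : ℝ)) * (δ ^ 2 * #N) ≤
      2 ^ (j₀ + 1) * M * Fintype.card Ω := by
    rw [sum_mul]
    calc _ ≤ ∑ j ∈ range (j₀ + 1), (2 : ℝ) ^ j * M * Fintype.card Ω :=
          sum_le_sum fun j hj => hbE j (by have := mem_range.1 hj; omega)
      _ = (∑ j ∈ range (j₀ + 1), (2 : ℝ) ^ j) * M * Fintype.card Ω := by
          rw [sum_mul, sum_mul]
      _ ≤ _ := by
          have hg : ∑ j ∈ range (j₀ + 1), (2 : ℝ) ^ j ≤ 2 ^ (j₀ + 1) := by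
            rw [geom_sum_eq (by norm_num)]
            norm_num
          gcongr
  have hsumE' : (∑ j ∈ range (j₀ + 1), (#(E j) : ℝ)) * (δ ^ 2 * k) ≤
      8 * M * Fintype.card Ω := by
    set s := ∑ j ∈ range (j₀ + 1), (#(E j) : ℝ) with hs
    have hs0 : 0 ≤ s := sum_nonneg fun _ _ => Nat.cast_nonneg _
    have h12 : (k * 2 ^ j₀ : ℝ) ≤ 4 * #N := by exact_mod_cast hj₀4.le
    have h13 : #N * (s * (δ ^ 2 * k)) ≤ #N * (8 * M * Fintype.card Ω) := by
      calc #N * (s * (δ ^ 2 * k)) = k * (s * (δ ^ 2 * #N)) := by ring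
        _ ≤ k * (2 ^ (j₀ + 1) * M * Fintype.card Ω) :=
          mul_le_mul_of_nonneg_left hsumE (Nat.cast_nonneg _)
        _ = (k * 2 ^ j₀) * (2 * M * Fintype.card Ω) := by ring
        _ ≤ (4 * #N) * (2 * M * Fintype.card Ω) :=
          mul_le_mul_of_nonneg_right h12 (by positivity)
        _ = _ := by ring
    exact le_of_mul_le_mul_left h13 hN0
  set s := ∑ j ∈ range (j₀ + 1), (#(E j) : ℝ) with hs
  have hs0 : 0 ≤ s := sum_nonneg fun _ _ => Nat.cast_nonneg _
  -- The `E j` take a share of at most `8 / 640` and `C` at most `2 / 640`, together `1 / 64`.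
  have hfin1 : 640 * s ≤ 8 * Fintype.card Ω := by
    have : M * (640 * s) ≤ M * (8 * Fintype.card Ω) := by
      calc M * (640 * s) = s * (640 * M) := by ring
        _ ≤ s * (δ ^ 2 * k) := mul_le_mul_of_nonneg_left hk hs0
        _ ≤ _ := hsumE'
        _ = _ := by ring
    exact le_of_mul_le_mul_left this (by linarith)
  have hfin2 : 640 * (#C : ℝ) ≤ 2 * Fintype.card Ω := by
    have : (0 : ℝ) ≤ #C := Nat.cast_nonneg _
    nlinarith
  linarith

/-! ### Pairwise independent affine hashing -/

section Hash

variable {F : Type} [Field F] {m : ℕ} (e : F ≃ Fin (2 ^ m))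

/-- The element `w` is sampled at level `j` under the affine hash function with seed `h`. -/
def Sampled (j : ℕ) (h : F × F) (w : F) : Prop :=
  ((e (h.1 * w + h.2) : ℕ) + 1) * 2 ^ j ≤ 2 ^ m

instance (j : ℕ) (h : F × F) (w : F) : Decidable (Sampled e j h w) :=
  inferInstanceAs (Decidable (_ ≤ _))

theorem sampled_zero (h : F × F) (w : F) : Sampled e 0 h w := by
  have := (e (h.1 * w + h.2)).2
  unfold Sampled
  omega

theorem Sampled.mono {i j : ℕ} (hij : i ≤ j) {h : F × F} {w : F} (hs : Sampled e j h w) :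
    Sampled e i h w :=
  (Nat.mul_le_mul_left _ (Nat.pow_le_pow_right (by norm_num) hij)).trans hs

/-- The `+ 1` in `Sampled` makes level `m + 1` empty, so a level with few sampled keys always
exists. -/
theorem not_sampled_succ (h : F × F) (w : F) : ¬ Sampled e (m + 1) h w := by
  unfold Sampled
  have : 0 < 2 ^ m := by positivity
  rw [pow_succ]
  nlinarith [Nat.zero_le (e (h.1 * w + h.2) : ℕ)]

variable [Fintype F]

theorem card_threshold {F : Type} [Fintype F] (e : F ≃ Fin (2 ^ m)) {j : ℕ} (hj : j ≤ m) :
    #{y : F | ((e y : ℕ) + 1) * 2 ^ j ≤ 2 ^ m} = 2 ^ (m - j) := by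
  have h1 : #{y : F | ((e y : ℕ) + 1) * 2 ^ j ≤ 2 ^ m} =
      #{y : Fin (2 ^ m) | (y : ℕ) < 2 ^ (m - j)} := by
    refine card_equiv e fun y => ?_
    simp only [mem_filter, mem_univ, true_and]
    have h : 2 ^ m = 2 ^ (m - j) * 2 ^ j := by rw [← pow_add]; congr 1; omega
    exact (iff_of_eq (congrArg _ h)).trans
      ((Nat.mul_le_mul_right_iff (by positivity)).trans Nat.succ_le_iff)
  rw [h1, Fin.card_filter_val_lt]
  exact min_eq_right (Nat.pow_le_pow_right (by norm_num) (by omega))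

/-- For a fixed slope, the hash value is a translate of the offset, hence uniform; the order `2 ^ m`
makes the sampling rate exactly `2 ^ (-j)`. -/
theorem card_sampled {j : ℕ} (hj : j ≤ m) (w : F) :
    ((#{h : F × F | Sampled e j h w} : ℕ) : ℝ) = (2 ^ j)⁻¹ * Fintype.card (F × F) := by
  classical
  have hF : Fintype.card F = 2 ^ m := by simpa using Fintype.card_congr e
  let φ : F × F ≃ F × F :=
    { toFun := fun h => (h.1, h.1 * w + h.2)
      invFun := fun h => (h.1, h.2 - h.1 * w)
      left_inv := fun h => by simp
      right_inv := fun h => by simp }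
  have h1 : #{h : F × F | Sampled e j h w} =
      #((univ : Finset F) ×ˢ ({y : F | ((e y : ℕ) + 1) * 2 ^ j ≤ 2 ^ m} : Finset F)) := by
    refine card_equiv φ fun h => ?_
    simp only [mem_filter, mem_univ, true_and, mem_product]
    exact Iff.rfl
  rw [h1, card_product, card_threshold e hj, Fintype.card_prod, card_univ, hF]
  have : (2 : ℝ) ^ m = 2 ^ (m - j) * 2 ^ j := by rw [← pow_add]; congr 1; omega
  push_cast
  rw [this]
  field_simp

/-- The seed `(a, b)` and the pair of values at two distinct points determine each other:
interpolation of an affine function. -/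
theorem card_sampled_pair {j : ℕ} (hj : j ≤ m) {w w' : F} (hw : w ≠ w') :
    ((#{h : F × F | Sampled e j h w ∧ Sampled e j h w'} : ℕ) : ℝ) =
      ((2 ^ j)⁻¹) ^ 2 * Fintype.card (F × F) := by
  classical
  have hF : Fintype.card F = 2 ^ m := by simpa using Fintype.card_congr e
  have hd : w - w' ≠ 0 := sub_ne_zero.2 hw
  let φ : F × F ≃ F × F :=
    { toFun := fun h => (h.1 * w + h.2, h.1 * w' + h.2)
      invFun := fun h => ((h.1 - h.2) / (w - w'), h.1 - (h.1 - h.2) / (w - w') * w)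
      left_inv := fun h => by
        ext
        · simp only; field_simp; ring
        · simp only; field_simp; ring
      right_inv := fun h => by
        ext
        · simp only; ring
        · simp only; field_simp; ring }
  set T : Finset F := {y : F | ((e y : ℕ) + 1) * 2 ^ j ≤ 2 ^ m} with hT
  have h1 : #{h : F × F | Sampled e j h w ∧ Sampled e j h w'} = #(T ×ˢ T) := by
    refine card_equiv φ fun h => ?_
    simp only [hT, mem_filter, mem_univ, true_and, mem_product]
    exact Iff.rfl
  rw [h1, card_product, hT, card_threshold e hj, Fintype.card_prod, hF]
  have : (2 : ℝ) ^ m = 2 ^ (m - j) * 2 ^ j := by rw [← pow_add]; congr 1; omega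
  push_cast
  rw [this]
  field_simp

end Hash

/-! ### Medians and amplification -/

section Median

theorem exists_median {T : ℕ} (hT : 0 < T) (f : Fin T → ℝ) :
    ∃ x, T ≤ 2 * #{t | f t ≤ x} ∧ T ≤ 2 * #{t | x ≤ f t} := by
  classical
  have : Nonempty (Fin T) := ⟨⟨0, hT⟩⟩
  -- The median is the least value with at least half of the values at or below it. Were fewer than
  -- half at or above it, the largest value strictly below it would also lie in `G`.
  set G : Finset (Fin T) := {t | T ≤ 2 * #{u | f u ≤ f t}} with hG
  have hne : G.Nonempty := by
    obtain ⟨t, -, ht⟩ := exists_max_image univ f univ_nonempty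
    refine ⟨t, ?_⟩
    rw [hG, mem_filter]
    refine ⟨mem_univ _, ?_⟩
    rw [filter_true_of_mem fun u _ => ht u (mem_univ _)]
    simp; omega
  obtain ⟨t, ht, hmin⟩ := exists_min_image G f hne
  refine ⟨f t, (mem_filter.1 ht).2, ?_⟩
  have hsplit : #{u | f u < f t} + #{u | f t ≤ f u} = T := by
    have := card_filter_add_card_filter_not (s := (univ : Finset (Fin T)))
      (fun u => f u < f t)
    simpa [not_lt] using this
  by_contra hcon
  push Not at hcon
  have hlt : T < 2 * #{u | f u < f t} := by omega
  have hne' : ({u | f u < f t} : Finset (Fin T)).Nonempty := by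
    rw [← card_pos]; omega
  obtain ⟨u, hu, hmax⟩ := exists_max_image _ f hne'
  have hu' := (mem_filter.1 hu).2
  have huG : u ∈ G := by
    rw [hG, mem_filter]
    refine ⟨mem_univ _, hlt.le.trans (Nat.mul_le_mul_left _ (card_le_card ?_))⟩
    intro v hv
    simp only [mem_filter, mem_univ, true_and]
    exact hmax v hv
  exact absurd (hmin u huG) (not_le.2 hu')

/-- A median of finitely many numbers. -/
noncomputable def median {T : ℕ} (f : Fin T → ℝ) : ℝ :=
  if hT : 0 < T then (exists_median hT f).choose else 0

theorem median_mem_Icc {T : ℕ} (f : Fin T → ℝ) {a b : ℝ}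
    (h : 2 * ({t | f t ∉ Set.Icc a b} : Set (Fin T)).ncard < T) : median f ∈ Set.Icc a b := by
  classical
  have hT : 0 < T := by omega
  rw [median, dif_pos hT]
  obtain ⟨h1, h2⟩ := (exists_median hT f).choose_spec
  set x := (exists_median hT f).choose
  constructor
  · by_contra hcon
    push Not at hcon
    have : ({t | f t ≤ x} : Finset (Fin T)).card ≤ ({t | f t ∉ Set.Icc a b} : Set (Fin T)).ncard := by
      rw [← Set.ncard_coe_finset]
      refine Set.ncard_le_ncard ?_ (Set.toFinite _)
      intro t ht hh
      have h3 : f t ≤ x := by simpa using ht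
      exact absurd hh.1 (by linarith)
    omega
  · by_contra hcon
    push Not at hcon
    have : ({t | x ≤ f t} : Finset (Fin T)).card ≤ ({t | f t ∉ Set.Icc a b} : Set (Fin T)).ncard := by
      rw [← Set.ncard_coe_finset]
      refine Set.ncard_le_ncard ?_ (Set.toFinite _)
      intro t ht hh
      have h3 : x ≤ f t := by simpa using ht
      exact absurd hh.2 (by linarith)
    omega

/-- Independent repetition: if at most a `1 / 64` fraction of the seeds is bad, then at most a
`4⁻ᵀ` fraction of the `T`-tuples of seeds is bad in at least half of the places. -/
theorem ncard_majority_bad_le {H : Type} [Fintype H] (Bd : Set H) (T : ℕ)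
    (hB : 64 * (Bd.ncard : ℝ) ≤ Fintype.card H) :
    4 ^ T * (({ω | T ≤ 2 * ({t | ω t ∈ Bd} : Set (Fin T)).ncard} : Set (Fin T → H)).ncard : ℝ) ≤
      Fintype.card (Fin T → H) := by
  classical
  -- Exponential moment: `g` has mean at most `2`, so its product over the `T` places has mean at
  -- most `2 ^ T`, while a bad majority makes it at least `64 ^ (T / 2) = 8 ^ T`. Markov's
  -- inequality gives `4⁻ᵀ`.
  set g : H → ℝ := fun h => if h ∈ Bd then 64 else 1 with hg
  have hg1 : ∀ h, 0 ≤ g h := fun h => by simp only [hg]; split_ifs <;> norm_num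
  have hsum : ∑ h, g h ≤ 2 * Fintype.card H := by
    have e : ∀ h, g h = 1 + 63 * (if h ∈ Bd then (1 : ℝ) else 0) := fun h => by
      simp only [hg]; split_ifs <;> norm_num
    simp_rw [e, sum_add_distrib, ← mul_sum, sum_boole]
    rw [Set.ncard_eq_toFinset_card', Set.toFinset_card, Fintype.card_subtype] at hB
    simp only [sum_const, card_univ, nsmul_eq_mul, mul_one]
    linarith [(Nat.cast_nonneg (#{h | h ∈ Bd}) : (0 : ℝ) ≤ _)]
  have hprod : ∑ ω : Fin T → H, ∏ t, g (ω t) = (∑ h, g h) ^ T := by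
    have := prod_univ_sum (fun _ : Fin T => (univ : Finset H)) (fun _ h => g h)
    simp only [prod_const, card_univ, Fintype.card_fin, Fintype.piFinset_univ] at this
    exact this.symm
  rw [Set.ncard_eq_toFinset_card']
  set Z := ({ω | T ≤ 2 * ({t | ω t ∈ Bd} : Set (Fin T)).ncard} : Set (Fin T → H)).toFinset with hZ
  have hmk : (8 : ℝ) ^ T * #Z ≤ (∑ h, g h) ^ T := by
    rw [← hprod, mul_comm, ← nsmul_eq_mul]
    refine (card_nsmul_le_sum Z (fun ω => ∏ t, g (ω t)) _ ?_).trans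
      (sum_le_sum_of_subset_of_nonneg (subset_univ _) fun ω _ _ => prod_nonneg fun t _ => hg1 _)
    intro ω hω
    have hω' : T ≤ 2 * ({t | ω t ∈ Bd} : Set (Fin T)).ncard := by
      rw [hZ, Set.mem_toFinset] at hω; exact hω
    have e : ∏ t, g (ω t) = 64 ^ ({t | ω t ∈ Bd} : Set (Fin T)).ncard := by
      simp only [hg]
      rw [prod_ite, prod_const, prod_const_one, mul_one, Set.ncard_eq_toFinset_card',
        Set.toFinset_card, Fintype.card_subtype]
      rfl
    rw [e, show (64 : ℝ) = 8 ^ 2 by norm_num, ← pow_mul]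
    exact pow_le_pow_right₀ (by norm_num) hω'
  have h2 : (∑ h, g h) ^ T ≤ (2 * (Fintype.card H : ℝ)) ^ T :=
    pow_le_pow_left₀ (sum_nonneg fun h _ => hg1 h) hsum T
  have h3 : (2 : ℝ) ^ T * (4 ^ T * #Z) ≤ 2 ^ T * (Fintype.card (Fin T → H)) := by
    calc (2 : ℝ) ^ T * (4 ^ T * #Z) = 8 ^ T * #Z := by
          rw [← mul_assoc, ← mul_pow]; norm_num
      _ ≤ _ := hmk.trans h2
      _ = _ := by rw [mul_pow]; simp
  exact le_of_mul_le_mul_left h3 (by positivity)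

end Median

/-! ### The one-pass sampler and its state space -/

section Sampler

variable {X ι μ : Type} [DecidableEq ι] (key : X → ι) (d : ι → List X → μ)
  (I : ℕ → ι → Prop) [∀ j w, Decidable (I j w)] (k L : ℕ) (hL : ∀ w, ¬ I L w)

/-- The keys occurring in a stream. -/
def seen (P : List X) : Finset ι := (P.map key).toFinset

/-- The part of a stream with a given key. -/
def part (P : List X) (w : ι) : List X := P.filter (fun x => key x = w)

theorem mem_seen {P : List X} {w : ι} : w ∈ seen key P ↔ ∃ x ∈ P, key x = w := by
  simp [seen]

theorem seen_append_singleton (P : List X) (x : X) :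
    seen key (P ++ [x]) = insert (key x) (seen key P) := by
  ext w
  simp [seen, eq_comm]

theorem part_append_singleton (P : List X) (x : X) (w : ι) :
    part key (P ++ [x]) w = if key x = w then part key P w ++ [x] else part key P w := by
  unfold part
  split_ifs with h <;> simp [h]

theorem part_eq_nil {P : List X} {w : ι} (h : w ∉ seen key P) : part key P w = [] := by
  rw [mem_seen] at h
  push Not at h
  simpa [part] using h

include hL in
theorem exists_level (P : List X) : ∃ j, #{w ∈ seen key P | I j w} ≤ k :=
  ⟨L, by simp [hL]⟩

/-- The first level at which at most `k` keys are sampled. -/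
def level (P : List X) : ℕ := Nat.find (exists_level key I k L hL P)

theorem card_level_le (P : List X) :
    #{w ∈ seen key P | I (level key I k L hL P) w} ≤ k :=
  Nat.find_spec (exists_level key I k L hL P)

theorem lt_card_of_lt_level {P : List X} {j : ℕ} (hj : j < level key I k L hL P) :
    k < #{w ∈ seen key P | I j w} :=
  not_le.1 (Nat.find_min (exists_level key I k L hL P) hj)

theorem level_le (P : List X) : level key I k L hL P ≤ L :=
  Nat.find_min' _ (by simp [hL])

theorem level_mono (P : List X) (x : X) :
    level key I k L hL P ≤ level key I k L hL (P ++ [x]) := by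
  refine Nat.find_min' _ (le_trans (card_le_card ?_) (card_level_le key I k L hL (P ++ [x])))
  refine filter_subset_filter _ ?_
  rw [seen_append_singleton]
  exact subset_insert _ _

/-- The memory contents kept for the sampled keys. -/
def table (P : List X) (w : ι) : Option μ :=
  if w ∈ seen key P ∧ I (level key I k L hL P) w then some (d w (part key P w)) else none

theorem table_ne_none {P : List X} {w : ι} :
    table key d I k L hL P w ≠ none ↔ w ∈ seen key P ∧ I (level key I k L hL P) w := by
  unfold table
  split_ifs with h <;> simp [h]

variable (hI : ∀ i j w, i ≤ j → I j w → I i w)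
  (hd : ∀ w P Q x, d w P = d w Q → d w (P ++ [x]) = d w (Q ++ [x]))

-- By nestedness, a key sampled at a level no lower than the current one is sampled now, so the
-- table reveals whether it has occurred. This is all that is needed to recompute the level after
-- the next item.
include hI in
theorem seen_sampled_congr {P Q : List X}
    (h₁ : level key I k L hL P = level key I k L hL Q)
    (h₂ : table key d I k L hL P = table key d I k L hL Q) {j : ℕ}
    (hj : level key I k L hL P ≤ j) {w : ι} (hw : I j w) :
    w ∈ seen key P ↔ w ∈ seen key Q := by
  have h3 := table_ne_none key d I k L hL (P := P) (w := w)
  have h4 := table_ne_none key d I k L hL (P := Q) (w := w)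
  rw [h₂, h4, ← h₁] at h3
  have h5 := hI _ _ w hj hw
  tauto

include hI in
theorem level_append_congr_le {P Q : List X} (x : X)
    (h₁ : level key I k L hL P = level key I k L hL Q)
    (h₂ : table key d I k L hL P = table key d I k L hL Q) :
    level key I k L hL (P ++ [x]) ≤ level key I k L hL (Q ++ [x]) := by
  refine Nat.find_min' _ (le_trans (card_le_card ?_) (card_level_le key I k L hL (Q ++ [x])))
  intro w
  simp only [mem_filter, seen_append_singleton, mem_insert]
  rintro ⟨h3, h4⟩
  refine ⟨h3.imp_right fun h5 => ?_, h4⟩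
  exact (seen_sampled_congr key d I k L hL hI h₁ h₂
    (h₁.le.trans (level_mono key I k L hL Q x)) h4).1 h5

include hI in
theorem level_append_congr {P Q : List X} (x : X)
    (h₁ : level key I k L hL P = level key I k L hL Q)
    (h₂ : table key d I k L hL P = table key d I k L hL Q) :
    level key I k L hL (P ++ [x]) = level key I k L hL (Q ++ [x]) :=
  le_antisymm (level_append_congr_le key d I k L hL hI x h₁ h₂)
    (level_append_congr_le key d I k L hL hI x h₁.symm h₂.symm)

include hI hd in
theorem table_append_congr {P Q : List X} (x : X)
    (h₁ : level key I k L hL P = level key I k L hL Q)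
    (h₂ : table key d I k L hL P = table key d I k L hL Q) :
    table key d I k L hL (P ++ [x]) = table key d I k L hL (Q ++ [x]) := by
  have h3 := level_append_congr key d I k L hL hI x h₁ h₂
  funext w
  unfold table
  simp only [← h3, seen_append_singleton, mem_insert]
  by_cases hw : I (level key I k L hL (P ++ [x])) w
  · have hle := level_mono key I k L hL P x
    have h4 := seen_sampled_congr key d I k L hL hI h₁ h₂ hle hw
    -- A key sampled at the new level either already has its memory in the table or has not
    -- occurred, and then its part is empty.
    have h5 : d w (part key P w) = d w (part key Q w) := by
      by_cases hs : w ∈ seen key P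
      · have h6 := congrFun h₂ w
        have h7 := hI _ _ w hle hw
        unfold table at h6
        rw [if_pos ⟨hs, h7⟩, if_pos ⟨h4.1 hs, h₁ ▸ h7⟩] at h6
        exact Option.some.inj h6
      · rw [part_eq_nil key hs, part_eq_nil key (fun h => hs (h4.2 h))]
    have h8 : d w (part key (P ++ [x]) w) = d w (part key (Q ++ [x]) w) := by
      rw [part_append_singleton, part_append_singleton]
      split_ifs
      · exact hd _ _ _ _ h5
      · exact h5
    simp only [h8, h4]
  · simp [hw]

/-- The states of the sampler: a level, and memory contents for at most `k` keys. -/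
abbrev SamplerState (ι μ : Type) [Fintype ι] (k L : ℕ) : Type :=
  Fin (L + 1) × {g : ι → Option μ // ({w | g w ≠ none} : Set ι).ncard ≤ k}

variable [Fintype ι]

/-- The state of the sampler after a stream has been read. -/
def samplerState (P : List X) : SamplerState ι μ k L :=
  (⟨level key I k L hL P, Nat.lt_succ_of_le (level_le key I k L hL P)⟩,
    ⟨table key d I k L hL P, by
      refine le_trans (le_of_eq ?_) (card_level_le key I k L hL P)
      rw [← Set.ncard_coe_finset]
      congr 1
      ext w
      rw [coe_filter]
      exact table_ne_none key d I k L hL⟩)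

include hI hd in
theorem samplerState_append_congr {P Q : List X} (x : X)
    (h : samplerState key d I k L hL P = samplerState key d I k L hL Q) :
    samplerState key d I k L hL (P ++ [x]) = samplerState key d I k L hL (Q ++ [x]) := by
  have h1 := congrArg (fun z => (z.1 : ℕ)) h
  have h2 := congrArg (fun z => (z.2 : ι → Option μ)) h
  simp only [samplerState] at h1 h2
  refine Prod.ext (Fin.ext ?_) (Subtype.ext ?_)
  · exact level_append_congr key d I k L hL hI x h1 h2
  · exact table_append_congr key d I k L hL hI hd x h1 h2

/-- The estimate computed from a state of the sampler. -/
noncomputable def estimate (out : ι → μ → ℝ) (z : SamplerState ι μ k L) : ℝ :=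
  2 ^ (z.1 : ℕ) * ∑ w, (z.2.1 w).elim 0 (out w)

theorem estimate_samplerState (out : ι → μ → ℝ) (P : List X) :
    estimate k L out (samplerState key d I k L hL P) = 2 ^ (level key I k L hL P) *
      ∑ w ∈ seen key P with I (level key I k L hL P) w, out w (d w (part key P w)) := by
  unfold estimate samplerState table
  simp only
  congr 1
  rw [← filter_univ_mem (seen key P), filter_filter, sum_filter]
  refine sum_congr rfl fun w _ => ?_
  simp only [filter_univ_mem]
  split_ifs <;> simp

/-- A table is recovered from a list of `k` slots, each blank or holding one key with its memory;
the `+ 1` counts the blank. -/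
theorem card_table_le [Fintype μ] (ι : Type) [Fintype ι] (k : ℕ) :
    Nat.card {g : ι → Option μ // ({w | g w ≠ none} : Set ι).ncard ≤ k} ≤
      (Fintype.card ι * Fintype.card μ + 1) ^ k := by
  classical
  have hsurj : ∀ g : {g : ι → Option μ // ({w | g w ≠ none} : Set ι).ncard ≤ k},
      ∃ a : Fin k → Option (ι × μ), ∀ w y, g.1 w = some y ↔ ∃ i, a i = some (w, y) := by
    rintro ⟨g, hg⟩
    rw [Set.ncard_eq_toFinset_card'] at hg
    set N := ({w | g w ≠ none} : Set ι).toFinset with hN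
    have hmem : ∀ w, w ∈ N ↔ g w ≠ none := fun w => by simp [hN]
    let φ : Fin (#N) ≃ N := N.equivFin.symm
    refine ⟨fun i => if h : (i : ℕ) < #N then
      (g (φ ⟨i, h⟩)).map (fun y => ((φ ⟨i, h⟩ : ι), y)) else none, fun w y => ?_⟩
    constructor
    · intro hw
      change g w = some y at hw
      have hwN : w ∈ N := by rw [hmem, hw]; simp
      let i := φ.symm ⟨w, hwN⟩
      refine ⟨⟨i, lt_of_lt_of_le i.2 hg⟩, ?_⟩
      simp [i, hw]
    · rintro ⟨i, hi⟩
      dsimp only at hi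
      split_ifs at hi with h
      rw [Option.map_eq_some_iff] at hi
      obtain ⟨y', h1, h2⟩ := hi
      rw [Prod.mk.injEq] at h2
      rw [← h2.1, ← h2.2]
      exact h1
  choose a ha using hsurj
  have hinj : Function.Injective a := by
    intro g g' hgg
    refine Subtype.ext (funext fun w => Option.ext fun y => ?_)
    rw [ha g, ha g', hgg]
  have := Nat.card_le_card_of_injective a hinj
  simpa using this

end Sampler

/-! ### Bounds on the optimum -/

section Opt

variable {p : ENNReal} [Fact (1 ≤ p)]

theorem exists_opt_cover (P : List (Plane p)) :
    ∃ D : Finset (Plane p), D.card = opt P ∧ Covers D P :=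
  Nat.sInf_mem (exists_cover P)

theorem opt_le_card {D : Finset (Plane p)} {P : List (Plane p)} (h : Covers D P) :
    opt P ≤ D.card :=
  Nat.sInf_le ⟨D, rfl, h⟩

theorem opt_nil : opt ([] : List (Plane p)) = 0 :=
  Nat.le_zero.1 (opt_le_card (D := ∅) (by simp [Covers]))

theorem one_le_opt {P : List (Plane p)} (hP : P ≠ []) : 1 ≤ opt P := by
  obtain ⟨D, hD, hc⟩ := exists_opt_cover P
  obtain ⟨x, hx⟩ := List.exists_mem_of_ne_nil P hP
  obtain ⟨z, hz, -⟩ := hc x hx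
  rw [← hD]
  exact card_pos.2 ⟨z, hz⟩

theorem opt_le_sum_part {ι : Type} [DecidableEq ι] (key : Plane p → ι) (P : List (Plane p)) :
    opt P ≤ ∑ w ∈ seen key P, opt (part key P w) := by
  classical
  choose D hD hc using fun w => exists_opt_cover (part key P w)
  calc opt P ≤ #((seen key P).biUnion D) := by
        refine opt_le_card fun x hx => ?_
        obtain ⟨z, hz, hxz⟩ := hc (key x) x (by simp [part, hx])
        exact ⟨z, mem_biUnion.2 ⟨key x, (mem_seen key).2 ⟨x, hx, rfl⟩, hz⟩, hxz⟩
    _ ≤ _ := card_biUnion_le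
    _ = _ := sum_congr rfl fun w _ => hD w

/-- The `L_1` norm dominates every `L_p` norm, so an offset of at most `1 / 2` in each coordinate
stays within a unit disc, whatever `p` is. -/
theorem norm_le_abs_add_abs (x : Plane p) : ‖x‖ ≤ |x 0| + |x 1| := by
  have h : x = PiLp.single p 0 (x 0) + PiLp.single p 1 (x 1) := by
    ext i
    fin_cases i <;> simp
  calc ‖x‖ = ‖(PiLp.single p 0 (x 0) + PiLp.single p 1 (x 1) : Plane p)‖ := by rw [← h]
    _ ≤ _ := norm_add_le _ _
    _ = _ := by simp [PiLp.norm_single]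

theorem exists_near_half_integer {a t : ℝ} {ℓ : ℕ} (h₁ : a ≤ t) (h₂ : t ≤ a + 2 * ℓ)
    (hℓ : 0 < ℓ) : ∃ k : Fin (2 * ℓ), |t - (a + k + 1 / 2)| ≤ 1 / 2 := by
  -- The right end must be included because windows are closed at the top; there the floor would be
  -- one too large.
  rcases eq_or_lt_of_le h₂ with h | h
  · refine ⟨⟨2 * ℓ - 1, by omega⟩, ?_⟩
    have : ((2 * ℓ - 1 : ℕ) : ℝ) = 2 * ℓ - 1 := by
      rw [Nat.cast_sub (by omega)]; push_cast; ring
    rw [abs_le]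
    simp only [this]
    constructor <;> linarith
  · have h0 : 0 ≤ t - a := by linarith
    refine ⟨⟨⌊t - a⌋₊, (Nat.floor_lt h0).2 (by push_cast; linarith)⟩, ?_⟩
    have h3 := Nat.floor_le h0
    have h4 := Nat.lt_floor_add_one (t - a)
    rw [abs_le]
    constructor <;> simp only <;> linarith

/-- Cut the window into `4 * ℓ ^ 2` unit squares and put a disc at the centre of each. This bounds
the weights in the sampling argument. -/
theorem opt_le_of_subset_window {P : List (Plane p)} {ℓ : ℕ} (hℓ : 0 < ℓ) {w : ℤ × ℤ}
    (hP : ∀ x ∈ P, x ∈ window p ℓ w) : opt P ≤ 4 * ℓ ^ 2 := by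
  classical
  let c : Fin (2 * ℓ) × Fin (2 * ℓ) → Plane p := fun k =>
    WithLp.toLp p ![2 * (w.1 : ℝ) + (k.1 : ℕ) + 1 / 2,
      2 * (w.2 : ℝ) - 2 * ℓ + (k.2 : ℕ) + 1 / 2]
  calc opt P ≤ #(univ.image c) := by
        refine opt_le_card fun x hx => ?_
        obtain ⟨h1, h2, h3, h4⟩ := hP x hx
        obtain ⟨a, ha⟩ := exists_near_half_integer h1 h2.le hℓ
        obtain ⟨b, hb⟩ := exists_near_half_integer (a := 2 * (w.2 : ℝ) - 2 * ℓ) (ℓ := ℓ)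
          h3.le (by linarith) hℓ
        refine ⟨c (a, b), mem_image_of_mem _ (mem_univ _), ?_⟩
        rw [mem_closedBall_iff_norm]
        refine (norm_le_abs_add_abs _).trans ?_
        simp only [c, PiLp.sub_apply, Matrix.cons_val_zero, Matrix.cons_val_one]
        linarith
    _ ≤ #(univ : Finset (Fin (2 * ℓ) × Fin (2 * ℓ))) := card_image_le
    _ = 4 * ℓ ^ 2 := by simp; ring

end Opt

/-! ### Shifted subdivisions and the shifting lemma -/

section Shift

/-- The left end (in units of two) of the interval of length `2ℓ` that contains the cell `q`,
for the subdivision of the line shifted by `i`. -/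
def intervalStart (ℓ : ℕ) (q : ℤ) (i : Fin ℓ) : ℤ := ℓ * ((q - (i : ℕ)) / ℓ) + (i : ℕ)

theorem intervalStart_le {ℓ : ℕ} (hℓ : 0 < ℓ) (q : ℤ) (i : Fin ℓ) : intervalStart ℓ q i ≤ q := by
  have := Int.mul_ediv_self_le (x := q - (i : ℕ)) (k := (ℓ : ℤ)) (by omega)
  unfold intervalStart
  omega

theorem lt_intervalStart_add {ℓ : ℕ} (hℓ : 0 < ℓ) (q : ℤ) (i : Fin ℓ) :
    q < intervalStart ℓ q i + ℓ := by
  have := Int.lt_mul_ediv_self_add (x := q - (i : ℕ)) (k := (ℓ : ℤ)) (by omega)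
  unfold intervalStart
  omega

theorem floor_half_bounds (t : ℝ) : 2 * (⌊t / 2⌋ : ℝ) ≤ t ∧ t < 2 * (⌊t / 2⌋ : ℝ) + 2 := by
  have h1 := Int.floor_le (t / 2)
  have h2 := Int.lt_floor_add_one (t / 2)
  constructor <;> linarith

theorem intervalStart_bounds {ℓ : ℕ} (hℓ : 0 < ℓ) (t : ℝ) (i : Fin ℓ) :
    2 * (intervalStart ℓ ⌊t / 2⌋ i : ℝ) ≤ t ∧
      t < 2 * (intervalStart ℓ ⌊t / 2⌋ i : ℝ) + 2 * ℓ := by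
  obtain ⟨h1, h2⟩ := floor_half_bounds t
  have h3 : (intervalStart ℓ ⌊t / 2⌋ i : ℝ) ≤ ⌊t / 2⌋ := by
    exact_mod_cast intervalStart_le hℓ _ _
  have h4 : (⌊t / 2⌋ : ℝ) + 1 ≤ intervalStart ℓ ⌊t / 2⌋ i + ℓ := by
    exact_mod_cast lt_intervalStart_add hℓ ⌊t / 2⌋ i
  constructor <;> linarith

/-- The starts of the intervals that meet `[u - 1, u + 1]`. -/
noncomputable def intervalsNear (ℓ : ℕ) (u : ℝ) (i : Fin ℓ) : Finset ℤ :=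
  {intervalStart ℓ ⌊(u - 1) / 2⌋ i, intervalStart ℓ (⌊(u - 1) / 2⌋ + 1) i}

theorem intervalStart_mem_intervalsNear {ℓ : ℕ} {t u : ℝ} (h : |t - u| ≤ 1) (i : Fin ℓ) :
    intervalStart ℓ ⌊t / 2⌋ i ∈ intervalsNear ℓ u i := by
  obtain ⟨h1, h2⟩ := abs_le.1 h
  obtain ⟨h3, h4⟩ := floor_half_bounds t
  obtain ⟨h5, h6⟩ := floor_half_bounds (u - 1)
  have h7 : ⌊(u - 1) / 2⌋ ≤ ⌊t / 2⌋ := Int.floor_le_floor (by linarith)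
  have h8 : ⌊t / 2⌋ < ⌊(u - 1) / 2⌋ + 2 := by
    have : (⌊t / 2⌋ : ℝ) < (⌊(u - 1) / 2⌋ + 2 : ℤ) := by push_cast; linarith
    exact_mod_cast this
  rw [intervalsNear, mem_insert, mem_singleton]
  rcases (by omega : ⌊t / 2⌋ = ⌊(u - 1) / 2⌋ ∨ ⌊t / 2⌋ = ⌊(u - 1) / 2⌋ + 1) with h | h
  · left; rw [h]
  · right; rw [h]

/-- Two adjacent cells of length two suffice. A subdivision separates them only if its shift is
congruent to `q + 1` modulo `ℓ`, which holds for at most one `i`. -/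
theorem sum_card_intervalsNear_le {ℓ : ℕ} (hℓ : 0 < ℓ) (u : ℝ) :
    ∑ i, #(intervalsNear ℓ u i) ≤ ℓ + 1 := by
  set q := ⌊(u - 1) / 2⌋ with hq
  have h1 : ∀ i : Fin ℓ, #(intervalsNear ℓ u i) ≤ 1 + if (ℓ : ℤ) ∣ q + 1 - (i : ℕ) then 1 else 0 := by
    intro i
    split_ifs with h
    · exact card_le_two
    · have : intervalStart ℓ (q + 1) i = intervalStart ℓ q i := by
        unfold intervalStart
        congr 2
        rw [show q + 1 - (i : ℕ) = (q - (i : ℕ)) + 1 by ring] at h ⊢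
        have hl : (0 : ℤ) < ℓ := by exact_mod_cast hℓ
        set y := q - (i : ℕ)
        have h2 := Int.emod_nonneg y hl.ne'
        have h3 := Int.emod_lt_of_pos y hl
        have h4 := Int.mul_ediv_add_emod y ℓ
        have h5 : y % ℓ + 1 ≠ ℓ := by
          intro h5
          apply h
          refine ⟨y / ℓ + 1, ?_⟩
          rw [mul_add, mul_one]
          omega
        rw [Int.ediv_eq_iff_of_pos hl]
        constructor
        · rw [mul_comm]; omega
        · rw [mul_comm (y / ℓ)]; omega
      rw [intervalsNear, ← hq, this]
      simp
  refine (sum_le_sum fun i _ => h1 i).trans ?_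
  rw [sum_add_distrib, sum_const, card_univ, Fintype.card_fin, smul_eq_mul, mul_one, sum_boole]
  have h2 : #{i : Fin ℓ | (ℓ : ℤ) ∣ q + 1 - (i : ℕ)} ≤ 1 := by
    rw [card_le_one]
    intro i hi j hj
    have hi' := (mem_filter.1 hi).2
    have hj' := (mem_filter.1 hj).2
    have h3 := dvd_sub hi' hj'
    have h4 : q + 1 - ((i : ℕ) : ℤ) - (q + 1 - ((j : ℕ) : ℤ)) = (j : ℕ) - (i : ℕ) := by ring
    rw [h4] at h3
    have h5 := Int.eq_zero_of_abs_lt_dvd h3 (by rw [abs_lt]; omega)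
    exact Fin.ext (by omega)
  simpa using h2

variable {p : ENNReal}

/-- The window that contains the point `x`, for the subdivision of the plane shifted by
`σ`. -/
noncomputable def windowOf {ℓ : ℕ} (σ : Fin ℓ × Fin ℓ) (x : Plane p) : ℤ × ℤ :=
  -- The second coordinate is reflected so that half-open intervals closed on the left become closed
  -- at the top.
  (intervalStart ℓ ⌊x 0 / 2⌋ σ.1, -intervalStart ℓ ⌊(-x 1) / 2⌋ σ.2)

theorem mem_window_windowOf {ℓ : ℕ} (hℓ : 0 < ℓ) (σ : Fin ℓ × Fin ℓ) (x : Plane p) :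
    x ∈ window p ℓ (windowOf σ x) := by
  obtain ⟨h1, h2⟩ := intervalStart_bounds hℓ (x 0) σ.1
  obtain ⟨h3, h4⟩ := intervalStart_bounds hℓ (-x 1) σ.2
  refine ⟨h1, h2, ?_, ?_⟩ <;> simp only [windowOf] <;> push_cast <;> linarith

/-- The windows that may meet the unit disc around `z`. -/
noncomputable def windowsNear {ℓ : ℕ} (σ : Fin ℓ × Fin ℓ) (z : Plane p) : Finset (ℤ × ℤ) :=
  intervalsNear ℓ (z 0) σ.1 ×ˢ (intervalsNear ℓ (-z 1) σ.2).image Neg.neg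

theorem windowOf_mem_windowsNear [Fact (1 ≤ p)] {ℓ : ℕ} (σ : Fin ℓ × Fin ℓ) {x z : Plane p}
    (h : x ∈ Metric.closedBall z 1) : windowOf σ x ∈ windowsNear σ z := by
  rw [mem_closedBall_iff_norm] at h
  have h0 := (PiLp.norm_apply_le (x - z) 0).trans h
  have h1 := (PiLp.norm_apply_le (x - z) 1).trans h
  rw [PiLp.sub_apply, Real.norm_eq_abs] at h0 h1
  refine mem_product.2 ⟨intervalStart_mem_intervalsNear h0 _, mem_image_of_mem _ ?_⟩
  refine intervalStart_mem_intervalsNear ?_ _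
  rw [← abs_neg, show -(-x 1 - -z 1) = x 1 - z 1 by ring]
  exact h1

theorem sum_card_windowsNear_le {ℓ : ℕ} (hℓ : 0 < ℓ) (z : Plane p) :
    ∑ σ : Fin ℓ × Fin ℓ, #(windowsNear σ z) ≤ (ℓ + 1) ^ 2 := by
  calc ∑ σ : Fin ℓ × Fin ℓ, #(windowsNear σ z)
      = ∑ σ : Fin ℓ × Fin ℓ, #(intervalsNear ℓ (z 0) σ.1) * #(intervalsNear ℓ (-z 1) σ.2) := by
        refine sum_congr rfl fun σ _ => ?_
        rw [windowsNear, card_product, card_image_of_injective _ neg_injective]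
    _ = (∑ i, #(intervalsNear ℓ (z 0) i)) * ∑ j, #(intervalsNear ℓ (-z 1) j) := by
        rw [Fintype.sum_prod_type, sum_mul_sum]
    _ ≤ _ := by
        rw [sq]
        exact Nat.mul_le_mul (sum_card_intervalsNear_le hℓ _) (sum_card_intervalsNear_le hℓ _)

/-- The discs of `D` near a window already cover its part of the stream; count pairs of a disc and a
nearby window in both orders. The decoder `ψ` ensures that distinct keys stand for distinct windows.
-/
theorem sum_opt_part_le [Fact (1 ≤ p)] {ℓ : ℕ} (σ : Fin ℓ × Fin ℓ) {F : Type} [DecidableEq F]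
    (φ : ℤ × ℤ → F) (P : List (Plane p)) {ψ : F → ℤ × ℤ}
    (hψ : ∀ x ∈ P, ψ (φ (windowOf σ x)) = windowOf σ x) {D : Finset (Plane p)}
    (hD : Covers D P) :
    ∑ w ∈ seen (fun x => φ (windowOf σ x)) P, opt (part (fun x => φ (windowOf σ x)) P w) ≤
      ∑ z ∈ D, #(windowsNear σ z) := by
  classical
  set key : Plane p → F := fun x => φ (windowOf σ x) with hkey
  have h1 : ∀ w ∈ seen key P, opt (part key P w) ≤ #{z ∈ D | ψ w ∈ windowsNear σ z} := by
    intro w _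
    refine opt_le_card fun x hx => ?_
    simp only [part, List.mem_filter, decide_eq_true_eq] at hx
    obtain ⟨z, hz, hxz⟩ := hD x hx.1
    refine ⟨z, mem_filter.2 ⟨hz, ?_⟩, hxz⟩
    rw [← hx.2, hkey]
    simp only
    rw [hψ x hx.1]
    exact windowOf_mem_windowsNear σ hxz
  refine (sum_le_sum h1).trans ?_
  have h2 : ∑ w ∈ seen key P, #{z ∈ D | ψ w ∈ windowsNear σ z} =
      ∑ z ∈ D, #{w ∈ seen key P | ψ w ∈ windowsNear σ z} := by
    simp only [card_filter]
    exact sum_comm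
  rw [h2]
  refine sum_le_sum fun z _ => card_le_card_of_injOn ψ (fun w hw => ?_) ?_
  · exact (mem_filter.1 hw).2
  · intro w hw w' hw' hww
    obtain ⟨x, hx, rfl⟩ := (mem_seen key).1 (mem_filter.1 hw).1
    obtain ⟨y, hy, rfl⟩ := (mem_seen key).1 (mem_filter.1 hw').1
    simp only [hkey] at hww ⊢
    rw [hψ x hx, hψ y hy] at hww
    rw [hww]

/-- The shifting lemma: for some shift, the optima of the windows add up to at most
`(1 + 1 / ℓ) ^ 2` times the optimum. -/
theorem exists_shift [Fact (1 ≤ p)] {ℓ : ℕ} (hℓ : 0 < ℓ) {F : Type} [DecidableEq F]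
    (φ : Fin ℓ × Fin ℓ → ℤ × ℤ → F) (ψ : Fin ℓ × Fin ℓ → F → ℤ × ℤ) (P : List (Plane p))
    (hψ : ∀ σ, ∀ x ∈ P, ψ σ (φ σ (windowOf σ x)) = windowOf σ x) :
    ∃ σ : Fin ℓ × Fin ℓ, ℓ ^ 2 * ∑ w ∈ seen (fun x => φ σ (windowOf σ x)) P,
      opt (part (fun x => φ σ (windowOf σ x)) P w) ≤ (ℓ + 1) ^ 2 * opt P := by
  obtain ⟨D, hD, hc⟩ := exists_opt_cover P
  by_contra hcon
  push Not at hcon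
  have hne : (univ : Finset (Fin ℓ × Fin ℓ)).Nonempty := ⟨(⟨0, hℓ⟩, ⟨0, hℓ⟩), mem_univ _⟩
  have h1 := sum_lt_sum_of_nonempty hne fun σ _ => hcon σ
  have h2 : ∑ σ : Fin ℓ × Fin ℓ, ∑ w ∈ seen (fun x => φ σ (windowOf σ x)) P,
      opt (part (fun x => φ σ (windowOf σ x)) P w) ≤ opt P * (ℓ + 1) ^ 2 := by
    calc _ ≤ ∑ σ : Fin ℓ × Fin ℓ, ∑ z ∈ D, #(windowsNear σ z) :=
          sum_le_sum fun σ _ => sum_opt_part_le σ (φ σ) P (hψ σ) hc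
      _ = ∑ z ∈ D, ∑ σ : Fin ℓ × Fin ℓ, #(windowsNear σ z) := sum_comm
      _ ≤ ∑ z ∈ D, (ℓ + 1) ^ 2 := sum_le_sum fun z _ => sum_card_windowsNear_le hℓ z
      _ = _ := by rw [sum_const, hD, smul_eq_mul]
  rw [sum_const, card_univ, Fintype.card_prod, Fintype.card_fin, smul_eq_mul] at h1
  have h3 := Nat.mul_le_mul_left (ℓ ^ 2) h2
  rw [mul_sum] at h3
  have h4 : ℓ ^ 2 * (opt P * (ℓ + 1) ^ 2) = ℓ * ℓ * ((ℓ + 1) ^ 2 * opt P) := by ring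
  omega

end Shift

/-! ### Window codes, space accounting and assembly -/

theorem exists_code {α F : Type} [Nonempty α] [Nonempty F] [Fintype F] (R : Finset α)
    (hR : #R ≤ Fintype.card F) : ∃ (φ : α → F) (ψ : F → α), ∀ w ∈ R, ψ (φ w) = w := by
  classical
  obtain ⟨g⟩ : Nonempty (R ↪ F) := Function.Embedding.nonempty_of_card_le (by simpa using hR)
  let φ : α → F := fun a => if h : a ∈ R then g ⟨a, h⟩ else Classical.arbitrary F
  have hφ : Set.InjOn φ R := by
    intro a ha b hb hab
    rw [mem_coe] at ha hb
    simp only [φ, dif_pos ha, dif_pos hb] at hab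
    exact congrArg Subtype.val (g.injective hab)
  exact ⟨φ, Function.invFunOn φ R, fun w hw => hφ.leftInvOn_invFunOn hw⟩

/-- For all but a `1 / 64` fraction of the seeds, the sampler estimates the total weight of the
keys of a stream up to a factor of `r` and a relative error of `δ`. -/
theorem card_bad_estimates_le {X F μ : Type} [Field F] [Fintype F] [DecidableEq F] {m : ℕ}
    (e : F ≃ Fin (2 ^ m)) (key : X → F) (d : F → List X → μ) (out : F → μ → ℝ) (k : ℕ)
    (P : List X) (v : F → ℝ) {M δ r : ℝ} (hδ : 0 < δ) (hδ1 : δ ≤ 1) (hM : 1 ≤ M)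
    (hk : 640 * M ≤ δ ^ 2 * k)
    (hv : ∀ w ∈ seen key P, 1 ≤ v w ∧ v w ≤ M)
    (hout : ∀ w ∈ seen key P,
      v w ≤ out w (d w (part key P w)) ∧ out w (d w (part key P w)) ≤ r * v w) :
    64 * (({h | estimate k (m + 1) out (samplerState key d (fun j w => Sampled e j h w) k (m + 1)
        (not_sampled_succ e h) P) ∉
      Set.Icc ((1 - δ) * ∑ w ∈ seen key P, v w) (r * ((1 + δ) * ∑ w ∈ seen key P, v w))} :
        Set (F × F)).ncard : ℝ) ≤ Fintype.card (F × F) := by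
  have hcard : #(seen key P) ≤ 2 ^ m := by
    have : Fintype.card F = 2 ^ m := by simpa using Fintype.card_congr e
    rw [← this]
    exact card_le_univ _
  refine le_trans ?_ (card_inaccurate_seeds_le (fun j h w => Sampled e j h w) (seen key P) v m k
    M δ (sampled_zero e) (fun j hj w => card_sampled e hj w)
    (fun j hj w w' hw => card_sampled_pair e hj hw) hcard hv hδ hδ1 hM hk)
  refine mul_le_mul_of_nonneg_left (Nat.cast_le.2 (Set.ncard_le_ncard ?_ (Set.toFinite _)))
    (by norm_num)
  intro h hh
  by_contra hcon
  apply hh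
  set S := ∑ w ∈ seen key P, v w with hS
  set J := level key (fun j w => Sampled e j h w) k (m + 1) (not_sampled_succ e h) P with hJ
  rw [estimate_samplerState, ← hJ]
  have hacc : |2 ^ J * sampledSum (fun h w => Sampled e J h w) (seen key P) v h - S| ≤ δ * S := by
    by_contra hlt
    exact hcon ⟨J, card_level_le key (fun j w => Sampled e j h w) k _ (not_sampled_succ e h) P,
      fun i hi => lt_card_of_lt_level key (fun j w => Sampled e j h w) k _ (not_sampled_succ e h) hi, not_le.1 hlt⟩
  obtain ⟨h1, h2⟩ := abs_le.1 hacc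
  have h3 : sampledSum (fun h w => Sampled e J h w) (seen key P) v h ≤
      ∑ w ∈ seen key P with Sampled e J h w, out w (d w (part key P w)) :=
    sum_le_sum fun w hw => (hout w (mem_filter.1 hw).1).1
  have h4 : ∑ w ∈ seen key P with Sampled e J h w, out w (d w (part key P w)) ≤
      r * sampledSum (fun h w => Sampled e J h w) (seen key P) v h := by
    rw [sampledSum, mul_sum]
    exact sum_le_sum fun w hw => (hout w (mem_filter.1 hw).1).2
  have hJ0 : (0 : ℝ) < 2 ^ J := by positivity
  constructor
  · have := mul_le_mul_of_nonneg_left h3 hJ0.le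
    linarith
  · rcases (seen key P).eq_empty_or_nonempty with h0 | ⟨w, hw⟩
    · simp [hS, h0]
    · have hr : 0 ≤ r := by
        have a1 := hv w hw
        have a2 := hout w hw
        nlinarith
      calc _ ≤ 2 ^ J * (r * sampledSum (fun h w => Sampled e J h w) (seen key P) v h) :=
            mul_le_mul_of_nonneg_left h4 hJ0.le
        _ = r * (2 ^ J * sampledSum (fun h w => Sampled e J h w) (seen key P) v h) := by ring
        _ ≤ _ := mul_le_mul_of_nonneg_left (by linarith) hr

theorem clog_two_le {n : ℕ} (hn : 2 ≤ n) : (Nat.clog 2 n : ℝ) ≤ 4 * Real.log n := by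
  have h1 := Nat.pow_pred_clog_lt_self (b := 2) (by norm_num) (x := n) (by omega)
  have h2 : (2 : ℝ) ^ (Nat.clog 2 n - 1) ≤ n := by exact_mod_cast h1.le
  have h3 := Real.log_le_log (by positivity) h2
  rw [Real.log_pow] at h3
  have h4 : 1 ≤ Nat.clog 2 n := Nat.clog_pos (by norm_num) hn
  rw [Nat.cast_sub h4] at h3
  have h5 := Real.log_two_gt_d9
  have h6 : Real.log 2 ≤ Real.log n := Real.log_le_log (by norm_num) (by exact_mod_cast hn)
  have h7 : (1 : ℝ) ≤ Nat.clog 2 n := by exact_mod_cast h4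
  push_cast at h3
  nlinarith

theorem log_ge_half {n : ℕ} (hn : 2 ≤ n) : 1 / 2 ≤ Real.log n := by
  have h5 := Real.log_two_gt_d9
  have h6 : Real.log 2 ≤ Real.log n := Real.log_le_log (by norm_num) (by exact_mod_cast hn)
  linarith

/-- Here `m = O(log n)`, `T = O(log ℓ)` and `k = O(ℓ ^ 2 / ε ^ 2)`. Since `ε ≤ 1 / 2`, `log (1 / ε)`
is bounded below, so `log n` is absorbed into the product of logarithms. -/
theorem space_bound {c n ℓ s m T k s' : ℕ} {ε : ℝ} (hn : 2 ≤ n) (hℓ : 2 ≤ ℓ) (hε : 0 < ε)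
    (hε2 : ε ≤ 1 / 2) (hm : m = 2 * c * Nat.clog 2 n + 1) (hT : T = Nat.clog 2 ℓ + 4)
    (hk : k = ⌈40960 * (ℓ : ℝ) ^ 2 * (ε ^ 2)⁻¹⌉₊)
    (hs' : s' = 2 * m * T + ℓ ^ 2 * T * ((m + 2) + (m + s + 1) * k)) :
    (s' : ℝ) ≤ 12 * 40961 * (14 * (8 * c + 2) + 1) * ((ε ^ 2)⁻¹ * (ℓ : ℝ) ^ 4 * Real.log ℓ *
      ((s : ℝ) + Real.log (1 / ε) * Real.log n)) := by
  have hln := log_ge_half hn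
  have hll := log_ge_half hℓ
  have hle : 1 / 2 ≤ Real.log (1 / ε) := by
    have h5 := Real.log_two_gt_d9
    have : Real.log 2 ≤ Real.log (1 / ε) := by
      refine Real.log_le_log (by norm_num) ?_
      rw [le_div_iff₀ hε]
      linarith
    linarith
  have hcn := clog_two_le hn
  have hcl := clog_two_le hℓ
  have hT' : (T : ℝ) ≤ 12 * Real.log ℓ := by rw [hT]; push_cast; linarith
  have hm' : (m : ℝ) ≤ (8 * c + 2) * Real.log n := by
    rw [hm]; push_cast
    have := mul_le_mul_of_nonneg_left hcn (by positivity : (0 : ℝ) ≤ 2 * c)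
    nlinarith
  have hq : (1 : ℝ) ≤ (ℓ : ℝ) ^ 2 * (ε ^ 2)⁻¹ := by
    have h1 : (1 : ℝ) ≤ (ℓ : ℝ) ^ 2 := one_le_pow₀ (by exact_mod_cast (by omega : 1 ≤ ℓ))
    have h2 : (1 : ℝ) ≤ (ε ^ 2)⁻¹ := (one_le_inv₀ (by positivity)).2 (by nlinarith)
    nlinarith
  have hk' : (k : ℝ) ≤ 40961 * ((ℓ : ℝ) ^ 2 * (ε ^ 2)⁻¹) := by
    have := Nat.ceil_lt_add_one (a := 40960 * (ℓ : ℝ) ^ 2 * (ε ^ 2)⁻¹) (by positivity)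
    rw [← hk] at this
    linarith
  have hk1 : 1 ≤ k := by
    rw [hk, Nat.one_le_ceil_iff]
    positivity
  have hm1 : 1 ≤ m := by omega
  have hnat : s' ≤ ℓ ^ 2 * T * (k * (7 * m + s)) := by
    have h1 : 2 * m * T ≤ ℓ ^ 2 * T * (2 * m) := by
      calc 2 * m * T = 1 * T * (2 * m) := by ring
        _ ≤ _ := by
          gcongr
          exact Nat.one_le_pow _ _ (by omega)
    have h2 : 2 * m + (m + 2) + (m + s + 1) * k ≤ k * (7 * m + s) := by
      nlinarith [Nat.mul_le_mul hk1 hm1]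
    calc s' ≤ ℓ ^ 2 * T * (2 * m) + ℓ ^ 2 * T * ((m + 2) + (m + s + 1) * k) := by
          rw [hs']; omega
      _ = ℓ ^ 2 * T * (2 * m + (m + 2) + (m + s + 1) * k) := by ring
      _ ≤ _ := Nat.mul_le_mul_left _ h2
  have hs0 : (0 : ℝ) ≤ s := Nat.cast_nonneg _
  have hc0 : (0 : ℝ) ≤ c := Nat.cast_nonneg _
  have h7 : (7 * m + s : ℝ) ≤
      (14 * (8 * c + 2) + 1) * ((s : ℝ) + Real.log (1 / ε) * Real.log n) := by
    have h8 : Real.log n ≤ 2 * (Real.log (1 / ε) * Real.log n) := by nlinarith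
    have h9 : (m : ℝ) ≤ (8 * c + 2) * (2 * (Real.log (1 / ε) * Real.log n)) :=
      hm'.trans (mul_le_mul_of_nonneg_left h8 (by positivity))
    have h10 : 0 ≤ Real.log (1 / ε) * Real.log n := mul_nonneg (by linarith) (by linarith)
    have h11 : 0 ≤ (14 * (8 * c + 2) : ℝ) * s := by positivity
    nlinarith
  have hll0 : (0 : ℝ) ≤ Real.log ℓ := by linarith
  calc (s' : ℝ) ≤ (ℓ : ℝ) ^ 2 * T * (k * (7 * m + s)) := by exact_mod_cast hnat
    _ ≤ (ℓ : ℝ) ^ 2 * (12 * Real.log ℓ) * ((40961 * ((ℓ : ℝ) ^ 2 * (ε ^ 2)⁻¹)) *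
        ((14 * (8 * c + 2) + 1) * ((s : ℝ) + Real.log (1 / ε) * Real.log n))) := by
      gcongr
    _ = _ := by ring

/-- The exponent has `2 * m` bits for each of `T` seeds and, for each shift and repetition, `m + 2`
bits for the level and `m + s + 1` bits for each of the `k` slots. -/
theorem card_states_le {F μ : Type} [Fintype F] [Fintype μ] {m s k T ℓ : ℕ}
    (hF : Fintype.card F = 2 ^ m) (hμ : Fintype.card μ = 2 ^ s) :
    Nat.card (Fin T → F × F) *
      Nat.card (Fin ℓ × Fin ℓ → Fin T → SamplerState F μ k (m + 1)) ≤
        2 ^ (2 * m * T + ℓ ^ 2 * T * ((m + 2) + (m + s + 1) * k)) := by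
  have h1 : Nat.card (SamplerState F μ k (m + 1)) ≤ 2 ^ ((m + 2) + (m + s + 1) * k) := by
    rw [Nat.card_prod, Nat.card_fin, pow_add]
    refine Nat.mul_le_mul (Nat.lt_two_pow_self).le ((card_table_le F k).trans ?_)
    rw [hF, hμ, pow_mul]
    refine Nat.pow_le_pow_left ?_ k
    rw [← pow_add, pow_succ]
    have := Nat.one_le_two_pow (n := m + s)
    omega
  have h2 : Nat.card (Fin ℓ × Fin ℓ → Fin T → SamplerState F μ k (m + 1)) ≤
      2 ^ (ℓ ^ 2 * T * ((m + 2) + (m + s + 1) * k)) := by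
    generalize SamplerState F μ k (m + 1) = Z at h1
    rw [Nat.card_fun, Nat.card_fun, Nat.card_prod, Nat.card_fin, Nat.card_fin, ← pow_mul,
      mul_comm (ℓ ^ 2 * T), pow_mul 2]
    refine (Nat.pow_le_pow_left h1 _).trans (le_of_eq ?_)
    congr 1
    ring
  rw [pow_add]
  refine Nat.mul_le_mul (le_of_eq ?_) h2
  rw [Nat.card_fun, Nat.card_prod, Nat.card_fin, Nat.card_eq_fintype_card, hF, ← pow_add, ← pow_mul]
  congr 1
  ring

end UnitDiscCover

open Finset UnitDiscCover in
/-- The least of the rescaled medians over all shifts approximates the optimum. -/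
theorem UnitDiscCover.median_min_mem_Icc {p : ENNReal} [Fact (1 ≤ p)] {ℓ T : ℕ} (hℓ : 0 < ℓ)
    {F : Type} [DecidableEq F] (φ : Fin ℓ × Fin ℓ → ℤ × ℤ → F) (ψ : Fin ℓ × Fin ℓ → F → ℤ × ℤ)
    (P : List (Plane p)) (hψ : ∀ σ, ∀ x ∈ P, ψ σ (φ σ (windowOf σ x)) = windowOf σ x)
    {ε r : ℝ} (hε : 0 < ε) (hε2 : ε ≤ 1 / 2) (hr : P = [] ∨ 0 ≤ r)
    (est : Fin ℓ × Fin ℓ → Fin T → ℝ) (hne : (univ : Finset (Fin ℓ × Fin ℓ)).Nonempty)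
    (hest : ∀ σ, median (est σ) ∈ Set.Icc
      ((1 - ε / 4) * ∑ w ∈ seen (fun x => φ σ (windowOf σ x)) P,
        (opt (part (fun x => φ σ (windowOf σ x)) P w) : ℝ))
      (r * ((1 + ε / 4) * ∑ w ∈ seen (fun x => φ σ (windowOf σ x)) P,
        (opt (part (fun x => φ σ (windowOf σ x)) P w) : ℝ)))) :
    univ.inf' hne (fun σ => median (est σ) / (1 - ε / 4)) ∈
      Set.Icc (opt P : ℝ) ((1 + ε) * (1 + 4 / (ℓ : ℝ)) ^ 2 * r * opt P) := by
  have h1 : 0 < 1 - ε / 4 := by linarith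
  constructor
  -- Dividing by `1 - ε / 4` removes the underestimate, so no shift falls below the optimum; only
  -- the upper bound needs the good shift.
  · refine le_inf' _ _ fun σ _ => ?_
    rw [le_div_iff₀ h1]
    refine le_trans ?_ (hest σ).1
    rw [mul_comm]
    refine mul_le_mul_of_nonneg_left ?_ h1.le
    exact_mod_cast opt_le_sum_part (fun x => φ σ (windowOf σ x)) P
  · obtain ⟨σ, hσ⟩ := exists_shift hℓ φ ψ P hψ
    refine (inf'_le _ (mem_univ σ)).trans ?_
    have h2 := (hest σ).2
    set S : ℝ := ∑ w ∈ seen (fun x => φ σ (windowOf σ x)) P,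
        (opt (part (fun x => φ σ (windowOf σ x)) P w) : ℝ) with hS
    have hS0 : 0 ≤ S := sum_nonneg fun _ _ => Nat.cast_nonneg _
    have h3 : (ℓ : ℝ) ^ 2 * S ≤ (ℓ + 1) ^ 2 * opt P := by
      rw [hS]; exact_mod_cast hσ
    have hl : (0 : ℝ) < ℓ := by exact_mod_cast hℓ
    have h4 : S ≤ (1 + 4 / (ℓ : ℝ)) ^ 2 * opt P := by
      have h5 : (1 + 4 / (ℓ : ℝ)) ^ 2 * opt P = ((ℓ + 4) ^ 2 * opt P) / (ℓ : ℝ) ^ 2 := by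
        field_simp
      rw [h5, le_div_iff₀ (by positivity), mul_comm]
      refine h3.trans ?_
      gcongr
      norm_num
    rcases hr with rfl | hr
    · have hS' : S = 0 := by simp [hS, seen]
      rw [hS'] at h2
      rw [opt_nil]
      simp only [mul_zero, Nat.cast_zero] at h2 ⊢
      exact div_nonpos_of_nonpos_of_nonneg h2 h1.le
    · rw [div_le_iff₀ h1]
      have h6 : 1 + ε / 4 ≤ (1 + ε) * (1 - ε / 4) := by nlinarith
      calc _ ≤ _ := h2
        _ ≤ r * (((1 + ε) * (1 - ε / 4)) * ((1 + 4 / (ℓ : ℝ)) ^ 2 * opt P)) := by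
          refine mul_le_mul_of_nonneg_left ?_ hr
          exact mul_le_mul h6 h4 hS0 (by nlinarith)
        _ = _ := by ring

open Finset UnitDiscCover in
theorem mainTheorem1 (c : ℕ) :
    ∃ K : ℝ, 0 < K ∧
      ∀ (p : ENNReal) [Fact (1 ≤ p)] (n ℓ s : ℕ) (ε r : ℝ) (U : Finset ℝ)
        (A : ℤ × ℤ → UnitDiscCover.StreamAlg (UnitDiscCover.Plane p) s),
        2 ≤ n → 2 ≤ ℓ → 0 < ε → ε ≤ 1 / 2 →
        UnitDiscCover.IsCoordinateSet c n U →
        (∀ w : ℤ × ℤ, (A w).Approximates (UnitDiscCover.windowStreams p U n ℓ w) r 1) →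
        ∃ s' : ℕ,
          (s' : ℝ) ≤ K * ((ε ^ 2)⁻¹ * (ℓ : ℝ) ^ 4 * Real.log (ℓ : ℝ) *
            ((s : ℝ) + Real.log (1 / ε) * Real.log (n : ℝ))) ∧
          ∃ B : UnitDiscCover.StreamAlg (UnitDiscCover.Plane p) s',
            B.Approximates (UnitDiscCover.streams p U n)
              ((1 + ε) * (1 + 4 / (ℓ : ℝ)) ^ 2 * r) (99 / 100) := by
  classical
  refine ⟨12 * 40961 * (14 * (8 * c + 2) + 1), by positivity, ?_⟩
  intro p _ n ℓ s ε r U A hn hℓ hε hε2 hU hA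
  -- `2 ^ m` exceeds the at most `n ^ (2 * c)` windows that can occur, and the `+ 1` keeps the
  -- exponent of the Galois field nonzero. `k` comes from `640 * M ≤ δ ^ 2 * k` with `M = 4 * ℓ ^ 2`
  -- and `δ = ε / 4`.
  obtain ⟨m, hm⟩ : ∃ m, m = 2 * c * Nat.clog 2 n + 1 := ⟨_, rfl⟩
  obtain ⟨T, hT⟩ : ∃ T, T = Nat.clog 2 ℓ + 4 := ⟨_, rfl⟩
  obtain ⟨k, hk⟩ : ∃ k, k = ⌈40960 * (ℓ : ℝ) ^ 2 * (ε ^ 2)⁻¹⌉₊ := ⟨_, rfl⟩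
  have hℓ0 : 0 < ℓ := by omega
  obtain ⟨F, _, _, hF⟩ : ∃ (F : Type) (_ : Field F) (_ : Fintype F), Fintype.card F = 2 ^ m := by
    let _ : Fintype (GaloisField 2 m) := Fintype.ofFinite _
    refine ⟨GaloisField 2 m, inferInstance, inferInstance, ?_⟩
    rw [← Nat.card_eq_fintype_card]
    exact GaloisField.card 2 m (by omega)
  let e : F ≃ Fin (2 ^ m) := Fintype.equivFinOfCardEq hF
  -- codes for the windows
  let pt : ℝ × ℝ → UnitDiscCover.Plane p := fun u => WithLp.toLp p ![u.1, u.2]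
  have hcode : ∀ σ : Fin ℓ × Fin ℓ, ∃ (φ : ℤ × ℤ → F) (ψ : F → ℤ × ℤ),
      ∀ w ∈ (U ×ˢ U).image (fun u => windowOf σ (pt u)), ψ (φ w) = w := by
    intro σ
    refine exists_code _ (card_image_le.trans ?_)
    rw [card_product, hF]
    calc #U * #U ≤ n ^ c * n ^ c := Nat.mul_le_mul hU.1 hU.1
      _ = n ^ (2 * c) := by rw [← pow_add, two_mul]
      _ ≤ (2 ^ Nat.clog 2 n) ^ (2 * c) :=
        Nat.pow_le_pow_left (Nat.le_pow_clog (by norm_num) n) _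
      _ = 2 ^ (2 * c * Nat.clog 2 n) := by rw [← pow_mul, mul_comm]
      _ ≤ 2 ^ m := Nat.pow_le_pow_right (by norm_num) (by omega)
  choose φ ψ hφψ using hcode
  have hψ : ∀ P ∈ UnitDiscCover.streams p U n, ∀ σ, ∀ x ∈ P,
      ψ σ (φ σ (windowOf σ x)) = windowOf σ x := by
    intro P hP σ x hx
    refine hφψ σ _ (mem_image.2 ⟨(x 0, x 1), ?_, ?_⟩)
    · exact mem_product.2 ⟨hP.2 x hx 0, hP.2 x hx 1⟩
    · congr 1
      ext i
      fin_cases i <;> rfl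
  -- deterministic algorithms for the windows
  choose m₀ f hf using fun w => (A w).exists_deterministic
  let d : Fin ℓ × Fin ℓ → F → List (UnitDiscCover.Plane p) → UnitDiscCover.Memory s :=
    fun σ w P => P.foldl (f (ψ σ w)) (m₀ (ψ σ w))
  have hd : ∀ σ w P Q x, d σ w P = d σ w Q → d σ w (P ++ [x]) = d σ w (Q ++ [x]) := by
    intro σ w P Q x h
    simp only [d, List.foldl_append, List.foldl_cons, List.foldl_nil] at h ⊢
    rw [h]
  let key : Fin ℓ × Fin ℓ → UnitDiscCover.Plane p → F := fun σ x => φ σ (windowOf σ x)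
  -- All shifts share the same `T` seeds: the union bound over shifts needs no independence.
  let St : (Fin T → F × F) → List (UnitDiscCover.Plane p) →
      Fin ℓ × Fin ℓ → Fin T → SamplerState F (UnitDiscCover.Memory s) k (m + 1) :=
    fun ω P σ t => samplerState (key σ) (d σ) (fun j w => Sampled e j (ω t) w) k (m + 1)
      (not_sampled_succ e (ω t)) P
  have hSt : ∀ ω P Q x, St ω P = St ω Q → St ω (P ++ [x]) = St ω (Q ++ [x]) := by
    intro ω P Q x h
    funext σ t
    have h' := congrFun (congrFun h σ) t
    simp only [St] at h' ⊢
    exact samplerState_append_congr (key σ) (d σ) (fun j w => Sampled e j (ω t) w) k (m + 1)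
      (not_sampled_succ e (ω t)) (fun i j w hij hs => Sampled.mono e hij hs) (hd σ) x h'
  let est : Fin ℓ × Fin ℓ → SamplerState F (UnitDiscCover.Memory s) k (m + 1) → ℝ :=
    fun σ z => estimate k (m + 1) (fun w => (A (ψ σ w)).out) z
  have hne : (univ : Finset (Fin ℓ × Fin ℓ)).Nonempty :=
    ⟨(⟨0, hℓ0⟩, ⟨0, hℓ0⟩), mem_univ _⟩
  let _ : Fintype (SamplerState F (UnitDiscCover.Memory s) k (m + 1)) := Fintype.ofFinite _
  have hcard := card_states_le (μ := UnitDiscCover.Memory s) (k := k) (T := T) (ℓ := ℓ) hF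
    (by simp : Fintype.card (UnitDiscCover.Memory s) = 2 ^ s)
  rw [Nat.card_eq_fintype_card, Nat.card_eq_fintype_card] at hcard
  obtain ⟨B, hB⟩ := exists_streamAlg_of_states St hSt
    (fun _ z => univ.inf' hne fun σ => median (fun t => est σ (z σ t)) / (1 - ε / 4)) _ hcard
  refine ⟨_, space_bound (s := s) hn hℓ hε hε2 hm hT hk rfl, B, fun P hP => ?_⟩
  refine hB P (Set.Icc (opt P : ℝ) ((1 + ε) * (1 + 4 / (ℓ : ℝ)) ^ 2 * r * opt P)) (99 / 100) ?_
  -- correctness of the window algorithms on the parts of the stream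
  have hpart : ∀ σ, ∀ w ∈ seen (key σ) P,
      (∀ x ∈ part (key σ) P w, x ∈ UnitDiscCover.window p ℓ (ψ σ w)) ∧ part (key σ) P w ≠ [] := by
    intro σ w hw
    obtain ⟨y, hy, hyw⟩ := (mem_seen (key σ)).1 hw
    refine ⟨fun x hx => ?_, List.ne_nil_of_mem (a := y) ?_⟩
    · simp only [part, List.mem_filter, decide_eq_true_eq] at hx
      rw [← hx.2]
      simp only [key]
      rw [hψ P hP σ x hx.1]
      exact mem_window_windowOf hℓ0 σ x
    · simp [part, hy, hyw]
  have hout : ∀ σ, ∀ w ∈ seen (key σ) P,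
      (opt (part (key σ) P w) : ℝ) ≤ (A (ψ σ w)).out (d σ w (part (key σ) P w)) ∧
        (A (ψ σ w)).out (d σ w (part (key σ) P w)) ≤ r * opt (part (key σ) P w) := by
    intro σ w hw
    have hs : part (key σ) P w ∈ UnitDiscCover.windowStreams p U n ℓ (ψ σ w) :=
      ⟨⟨(List.length_filter_le _ _).trans hP.1,
        fun x hx => hP.2 x (List.mem_of_mem_filter hx)⟩, (hpart σ w hw).1⟩
    exact mem_of_one_le_toOuterMeasure (hA (ψ σ w) _ hs) (hf (ψ σ w) _)
  -- A nonempty part has a positive optimum, which forces `0 ≤ r`; the empty stream puts no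
  -- constraint on `r`.
  have hr : P = [] ∨ 0 ≤ r := by
    rcases P.eq_nil_or_concat with h | ⟨Q, x, h⟩
    · exact Or.inl h
    · right
      have hx : x ∈ P := by simp [h]
      obtain ⟨σ, -⟩ := hne
      have hw : key σ x ∈ seen (key σ) P := (mem_seen (key σ)).2 ⟨x, hx, rfl⟩
      have h1 := hout σ _ hw
      have h2 : (1 : ℝ) ≤ opt (part (key σ) P (key σ x)) := by
        exact_mod_cast one_le_opt (hpart σ _ hw).2
      nlinarith
  -- few bad seeds
  let good : Fin ℓ × Fin ℓ → Set ℝ := fun σ => Set.Icc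
    ((1 - ε / 4) * ∑ w ∈ seen (key σ) P, (opt (part (key σ) P w) : ℝ))
    (r * ((1 + ε / 4) * ∑ w ∈ seen (key σ) P, (opt (part (key σ) P w) : ℝ)))
  let Bd : Fin ℓ × Fin ℓ → Set (F × F) := fun σ => {h | est σ (samplerState (key σ) (d σ)
    (fun j w => Sampled e j h w) k (m + 1) (not_sampled_succ e h) P) ∉ good σ}
  have hBd : ∀ σ, 64 * ((Bd σ).ncard : ℝ) ≤ Fintype.card (F × F) := by
    intro σ
    refine card_bad_estimates_le e (key σ) (d σ) (fun w => (A (ψ σ w)).out) k P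
      (fun w => (opt (part (key σ) P w) : ℝ)) (M := 4 * (ℓ : ℝ) ^ 2) (by linarith)
      (by linarith) ?_ ?_ ?_ (hout σ)
    · have : (1 : ℝ) ≤ (ℓ : ℝ) ^ 2 := one_le_pow₀ (by exact_mod_cast hℓ0)
      linarith
    · have h1 : 40960 * (ℓ : ℝ) ^ 2 * (ε ^ 2)⁻¹ ≤ k := by rw [hk]; exact Nat.le_ceil _
      rw [← div_eq_mul_inv, div_le_iff₀ (by positivity)] at h1
      nlinarith
    · intro w hw
      obtain ⟨h1, h2⟩ := hpart σ w hw
      exact ⟨by exact_mod_cast one_le_opt h2, by exact_mod_cast opt_le_of_subset_window hℓ0 h1⟩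
  let Z : Fin ℓ × Fin ℓ → Set (Fin T → F × F) :=
    fun σ => {ω | T ≤ 2 * ({t | ω t ∈ Bd σ} : Set (Fin T)).ncard}
  have hZ : ∀ σ, 4 ^ T * ((Z σ).ncard : ℝ) ≤ Fintype.card (Fin T → F × F) := fun σ =>
    ncard_majority_bad_le (Bd σ) T (hBd σ)
  set G : Set (Fin T → F × F) := {ω | (univ.inf' hne fun σ =>
    median (fun t => est σ (St ω P σ t)) / (1 - ε / 4)) ∈
      Set.Icc (opt P : ℝ) ((1 + ε) * (1 + 4 / (ℓ : ℝ)) ^ 2 * r * opt P)} with hG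
  have hsub : Gᶜ ⊆ ⋃ σ ∈ (univ : Finset (Fin ℓ × Fin ℓ)), Z σ := by
    intro ω hω
    by_contra hcon
    apply hω
    simp only [mem_univ, Set.iUnion_true, Set.mem_iUnion, not_exists] at hcon
    refine median_min_mem_Icc hℓ0 φ ψ P (hψ P hP) hε hε2 hr
      (fun σ t => est σ (St ω P σ t)) hne fun σ => median_mem_Icc _ ?_
    exact not_le.1 (hcon σ)
  have hunion : (Gᶜ.ncard : ℝ) ≤ ∑ σ : Fin ℓ × Fin ℓ, ((Z σ).ncard : ℝ) := by
    have h1 := Set.ncard_le_ncard hsub (Set.toFinite _)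
    have h2 := h1.trans (Finset.set_ncard_biUnion_le univ Z)
    exact_mod_cast h2
  -- The `+ 4` in `T` contributes `4 ^ 4 = 256`, so after the union bound over `ℓ ^ 2` shifts the
  -- failure rate is at most `1 / 256 < 1 / 100`.
  have h4T : 256 * (ℓ : ℝ) ^ 2 ≤ 4 ^ T := by
    have h1 : (ℓ : ℝ) ≤ 2 ^ Nat.clog 2 ℓ := by
      exact_mod_cast Nat.le_pow_clog (by norm_num) ℓ
    rw [hT, pow_add, show (4 : ℝ) = 2 ^ 2 by norm_num, ← pow_mul, mul_comm 2, pow_mul]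
    have h2 := pow_le_pow_left₀ (Nat.cast_nonneg ℓ) h1 2
    norm_num
    linarith
  have hbad : 256 * (Gᶜ.ncard : ℝ) ≤ Fintype.card (Fin T → F × F) := by
    have hl : (0 : ℝ) < (ℓ : ℝ) ^ 2 := by positivity
    have h1 : 4 ^ T * (Gᶜ.ncard : ℝ) ≤ (ℓ : ℝ) ^ 2 * Fintype.card (Fin T → F × F) := by
      calc _ ≤ 4 ^ T * ∑ σ : Fin ℓ × Fin ℓ, ((Z σ).ncard : ℝ) :=
            mul_le_mul_of_nonneg_left hunion (by positivity)
        _ ≤ ∑ σ : Fin ℓ × Fin ℓ, (Fintype.card (Fin T → F × F) : ℝ) := by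
            rw [mul_sum]
            exact sum_le_sum fun σ _ => hZ σ
        _ = _ := by
            rw [sum_const, card_univ, nsmul_eq_mul, Fintype.card_prod, Fintype.card_fin]
            push_cast
            ring
    have h2 := mul_le_mul_of_nonneg_right h4T (Nat.cast_nonneg Gᶜ.ncard : (0 : ℝ) ≤ _)
    have h3 : (ℓ : ℝ) ^ 2 * (256 * (Gᶜ.ncard : ℝ)) ≤
        (ℓ : ℝ) ^ 2 * Fintype.card (Fin T → F × F) := by linarith
    exact le_of_mul_le_mul_left h3 hl
  have htot : (G.ncard : ℝ) + Gᶜ.ncard = Fintype.card (Fin T → F × F) := by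
    rw [← Nat.card_eq_fintype_card]
    exact_mod_cast Set.ncard_add_ncard_compl G
  linarith [(Nat.cast_nonneg _ : (0 : ℝ) ≤ Fintype.card (Fin T → F × F))]
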